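/- Let $\mathcal D$ be a $\mathbb C$-linear category with $\operatorname{Hom}(\mathrm{id}_{\mathcal D},\mathrm{id}_{\mathcal D})=\mathbb C\,\mathrm{id}$. Let $\operatorname{Aut}\mathcal D$ be the group of isomorphism classes of $\mathbb C$-linear auto-equivalences of $\mathcal D$ (under composition), and let $G\subset\operatorname{Aut}\mathcal D$ be a finite subgroup. An action of a group $H$ on $\mathcal D$ is a pair $(\rho,\theta)$ of $\mathbb C$-linear auto-equivalences $\rho_g\colon\mathcal D\to\mathcal D$ ($g\in H$) and isomorphisms of functors $\theta_{g,h}\colon\rho_g\rho_h\to\rho_{gh}$ ($g,h\in H$) such that $\theta_{gh,k}\circ(\theta_{g,h}\rho_k)=\theta_{g,hk}\circ(\rho_g\theta_{h,k})$ for all $g,h,k\in H$. It induces a homomorphism $H\to\operatorname{Aut}\mathcal D$, $g\mapsto[\rho_g]$. Two actions $(\rho,\theta)$, $(\rho',\theta')$ of $H$ on $\mathcal D$ are isomorphic if there are isomorphisms $\sigma_g\colon\rho_g\to\rho'_g$ with $\sigma_{gh}\circ\theta_{g,h}=\theta'_{g,h}\circ(\rho'_g\sigma_h)\circ(\sigma_g\rho_h)$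 for all $g,h\in H$. An action of $G$ lifts $G$ if the induced homomorphism is the inclusion $G\hookrightarrow\operatorname{Aut}\mathcal D$. The group $G$ acts trivially on $\mathbb C^*$. (a) There is a class $\alpha\in H^3(G,\mathbb C^*)$, depending only on $G\subset\operatorname{Aut}\mathcal D$, that vanishes if and only if there exists an action of $G$ on $\mathcal D$ lifting $G$. More precisely: representatives $\rho_g$ of all $g\in G$ and isomorphisms $\theta_{g,h}\colon\rho_g\rho_h\to\rho_{gh}$ exist and, for every choice of them, the composition $$\rho_g\rho_h\rho_k\xrightarrow{\theta_{g,h}\rho_k}\rho_{gh}\rho_k\xrightarrow{\theta_{gh,k}}\rho_{ghk}\xrightarrow{\theta_{g,hk}^{-1}}\rho_g\rho_{hk}\xrightarrow{\rho_g\theta_{h,k}^{-1}}\rho_g\rho_h\rho_k$$ is $c(g,h,k)\,\mathrm{id}$ for a $3$-cocycle $c\colon G^3\to\mathbb C^*$, and the class of $c$ is $\alpha$. Moreover, if an action lifting $G$ exists, the set of isomorphism classes of actions lifting $G$ is a torsor under $H^2(G,\mathbb C^*)$, where the class of a $2$-cocycle $\lambda\colon G^2\to\mathbb C^*$ sends the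 class of $(\rho,\theta)$ to the class of $(\rho,\lambda\theta)$. (b) There are a finite group $G'$, a surjection $\pi\colon G'\twoheadrightarrow G$ and an action of $G'$ on $\mathcal D$ such that the induced homomorphism $G'\to\operatorname{Aut}\mathcal D$ is the composition of $\pi$ and the inclusion $G\subset\operatorname{Aut}\mathcal D$. (c) If $G\cong\mathbb Z_n$, then for $\pi$ in (b) one can take the reduction map $\mathbb Z_{n^2}\to\mathbb Z_n$ followed by any given isomorphism $\mathbb Z_n\cong G$. -/

import Mathlib

open CategoryTheory

universe v u w

namespace CatAction

/-- A `ℂ`-linear auto-equivalence of the `ℂ`-linear category `D`. -/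
structure LinAutoEquiv (D : Type u) [Category.{v} D] [Preadditive D]
    [CategoryTheory.Linear ℂ D] where
  functor : D ⥤ D
  additive : functor.Additive
  linear : functor.Linear ℂ
  isEquivalence : functor.IsEquivalence

attribute [instance] LinAutoEquiv.additive LinAutoEquiv.linear LinAutoEquiv.isEquivalence

section

variable (D : Type u) [Category.{v} D] [Preadditive D] [CategoryTheory.Linear ℂ D]

/-- Two auto-equivalences are identified when they are isomorphic as functors. -/
instance linAutoEquivSetoid : Setoid (LinAutoEquiv D) where
  r F F' := Nonempty (F.functor ≅ F'.functor)
  iseqv :=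
    { refl := fun _ => ⟨Iso.refl _⟩
      symm := fun ⟨e⟩ => ⟨e.symm⟩
      trans := fun ⟨e⟩ ⟨e'⟩ => ⟨e ≪≫ e'⟩ }

/-- `Aut D`: isomorphism classes of `ℂ`-linear auto-equivalences of `D`. -/
def AutGroup : Type (max u v) := Quotient (linAutoEquivSetoid D)

end

section

variable {D : Type u} [Category.{v} D] [Preadditive D] [CategoryTheory.Linear ℂ D]

/-- The class `[F]` of an auto-equivalence in `Aut D`. -/
def AutGroup.mk (F : LinAutoEquiv D) : AutGroup D := Quotient.mk _ F

/-- The identity functor. -/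
def LinAutoEquiv.one : LinAutoEquiv D := ⟨𝟭 D, inferInstance, inferInstance, inferInstance⟩

/-- The composition `F ∘ F'` (first `F'`, then `F`). -/
def LinAutoEquiv.comp (F F' : LinAutoEquiv D) : LinAutoEquiv D :=
  ⟨F'.functor ⋙ F.functor, inferInstance, inferInstance, inferInstance⟩

/-- A quasi-inverse of `F`. -/
noncomputable def LinAutoEquiv.inv (F : LinAutoEquiv D) : LinAutoEquiv D :=
  haveI : F.functor.asEquivalence.functor.Additive := F.additive
  haveI : F.functor.asEquivalence.functor.Linear ℂ := F.linear
  ⟨F.functor.inv, F.functor.asEquivalence.inverse_additive,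
    F.functor.asEquivalence.inverseLinear ℂ, inferInstance⟩

/-- The group structure `[F] * [F'] = [F ∘ F']` on `Aut D`. -/
noncomputable instance : Group (AutGroup D) where
  mul := Quotient.map₂ LinAutoEquiv.comp
    (fun _ _ ⟨e⟩ _ _ ⟨e'⟩ => ⟨Functor.isoWhiskerRight e' _ ≪≫ Functor.isoWhiskerLeft _ e⟩)
  one := AutGroup.mk LinAutoEquiv.one
  inv := Quotient.map LinAutoEquiv.inv (fun F F' ⟨e⟩ =>
    ⟨(Functor.rightUnitor _).symm ≪≫
      Functor.isoWhiskerLeft _ F'.functor.asEquivalence.unitIso ≪≫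
      (Functor.associator _ _ _).symm ≪≫
      Functor.isoWhiskerRight (Functor.isoWhiskerLeft _ e.symm) _ ≪≫
      Functor.isoWhiskerRight F.functor.asEquivalence.counitIso _ ≪≫
      Functor.leftUnitor _⟩)
  mul_assoc := by
    rintro ⟨F⟩ ⟨F'⟩ ⟨F''⟩
    exact Quotient.sound ⟨(Functor.associator _ _ _).symm⟩
  one_mul := by
    rintro ⟨F⟩
    exact Quotient.sound ⟨Functor.rightUnitor _⟩
  mul_one := by
    rintro ⟨F⟩
    exact Quotient.sound ⟨Functor.leftUnitor _⟩
  inv_mul_cancel := by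
    rintro ⟨F⟩
    exact Quotient.sound ⟨F.functor.asEquivalence.unitIso.symm⟩

end

/-- Auto-equivalences `ρ_g` together with isomorphisms of functors
`θ_{g,h} : ρ_g ∘ ρ_h ≅ ρ_{gh}`, with no compatibility imposed on the `θ_{g,h}`. -/
structure PreAction (G : Type w) [Group G] (D : Type u) [Category.{v} D] [Preadditive D]
    [CategoryTheory.Linear ℂ D] where
  ρ : G → LinAutoEquiv D
  θ : ∀ g h : G, (ρ h).functor ⋙ (ρ g).functor ≅ (ρ (g * h)).functor

/-- The action axiom: for all `g, h, k` the two composites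
`ρ_g ρ_h ρ_k → ρ_{gh} ρ_k → ρ_{ghk}` and `ρ_g ρ_h ρ_k → ρ_g ρ_{hk} → ρ_{ghk}` agree.
The map `eqToHom` identifies `ρ_{(gh)k}` with `ρ_{g(hk)}`. -/
def PreAction.IsAssoc {G : Type w} [Group G] {D : Type u} [Category.{v} D] [Preadditive D]
    [CategoryTheory.Linear ℂ D] (P : PreAction G D) : Prop :=
  ∀ (g h k : G) (X : D),
    (P.θ g h).hom.app ((P.ρ k).functor.obj X) ≫ (P.θ (g * h) k).hom.app X ≫
        eqToHom (congrArg (fun a => (P.ρ a).functor.obj X) (mul_assoc g h k)) =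
      (P.ρ g).functor.map ((P.θ h k).hom.app X) ≫ (P.θ g (h * k)).hom.app X

/-- An action `(ρ, θ)` of the group `G` on the `ℂ`-linear category `D`. -/
structure GroupAction (G : Type w) [Group G] (D : Type u) [Category.{v} D] [Preadditive D]
    [CategoryTheory.Linear ℂ D] extends PreAction G D where
  assoc : toPreAction.IsAssoc

section

variable {G : Type w} [Group G] {D : Type u} [Category.{v} D] [Preadditive D]
  [CategoryTheory.Linear ℂ D]

/-- The induced homomorphism `G → Aut D`, `g ↦ [ρ_g]`. -/
noncomputable def PreAction.induced (P : PreAction G D) : G →* AutGroup D :=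
  MonoidHom.mk' (fun g => AutGroup.mk (P.ρ g))
    (fun g h => Quotient.sound ⟨(P.θ g h).symm⟩)

/-- Two actions on `D` are isomorphic if there is a `G`-functor `(id_D, σ)` between them: a family
of isomorphisms `σ_g : ρ_g ≅ ρ'_g` with `σ_{gh} ∘ θ_{g,h} = θ'_{g,h} ∘ (ρ'_g σ_h) ∘ (σ_g ρ_h)`. -/
def GroupAction.Isomorphic (A B : GroupAction G D) : Prop :=
  ∃ σ : ∀ g : G, (A.ρ g).functor ≅ (B.ρ g).functor, ∀ (g h : G) (X : D),
    (A.θ g h).hom.app X ≫ (σ (g * h)).hom.app X =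
      (σ g).hom.app ((A.ρ h).functor.obj X) ≫ (B.ρ g).functor.map ((σ h).hom.app X) ≫
        (B.θ g h).hom.app X

/-- The actions of `G` on `D` inducing a given homomorphism `ι : G → Aut D`. -/
def Lift (ι : G →* AutGroup D) : Type (max u v w) :=
  {A : GroupAction G D // A.induced = ι}

instance liftSetoid (ι : G →* AutGroup D) : Setoid (Lift ι) where
  r A B := A.1.Isomorphic B.1
  iseqv :=
    { refl := fun A => ⟨fun _ => Iso.refl _, fun g h X => by simp⟩
      symm := by
        rintro A B ⟨σ, hσ⟩
        refine ⟨fun g => (σ g).symm, fun g h X => ?_⟩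
        rw [← cancel_epi ((B.1.ρ g).functor.map ((σ h).hom.app X)),
          ← cancel_epi ((σ g).hom.app ((A.1.ρ h).functor.obj X))]
        have h1 := hσ g h X
        simp only [Iso.symm_hom, ← Category.assoc] at h1 ⊢
        rw [← h1]
        simp
      trans := by
        rintro A B C ⟨σ, hσ⟩ ⟨τ, hτ⟩
        refine ⟨fun g => σ g ≪≫ τ g, fun g h X => ?_⟩
        have h1 := hσ g h X
        have h2 := hτ g h X
        simp only [Iso.trans_hom, NatTrans.comp_app, Functor.map_comp, Category.assoc] at h1 h2 ⊢
        rw [reassoc_of% h1, h2]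
        simp }

/-- The set of isomorphism classes of actions of `G` on `D` inducing `ι : G → Aut D`. -/
def LiftClasses (ι : G →* AutGroup D) : Type (max u v w) := Quotient (liftSetoid ι)

/-- The isomorphism class of an action inducing `ι`. -/
def LiftClasses.mk {ι : G →* AutGroup D} (A : Lift ι) : LiftClasses ι := Quotient.mk _ A

end

/-- The trivial `G`-module `ℂˣ`, written additively. Mathlib's group cohomology wants the
coefficient ring `ℤ`, the group and the module in one universe, hence the `ULift`s. -/
noncomputable abbrev coeff (G : Type w) [Group G] : Rep.{w} (ULift.{w} ℤ) G :=
  Rep.trivial (ULift.{w} ℤ) G (ULift.{w} (Additive ℂˣ))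

/-- An element of the coefficient module as a nonzero complex number. -/
def toUnit (a : ULift.{w} (Additive ℂˣ)) : ℂˣ := Additive.toMul a.down

section

variable {G : Type w} [Group G] {D : Type u} [Category.{v} D] [Preadditive D]
  [CategoryTheory.Linear ℂ D]

/-- The function `c : G³ → ℂˣ` measures the failure of the associativity square: for all
`g, h, k`, the composition
`ρ_g ρ_h ρ_k → ρ_{gh} ρ_k → ρ_{ghk} → ρ_g ρ_{hk} → ρ_g ρ_h ρ_k`
of `θ_{g,h} ρ_k`, `θ_{gh,k}`, `θ_{g,hk}⁻¹` and `ρ_g θ_{h,k}⁻¹` is `c(g,h,k) · id`. -/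
def PreAction.IsDefect (P : PreAction G D) (c : G → G → G → ℂˣ) : Prop :=
  ∀ (g h k : G) (X : D),
    (P.θ g h).hom.app ((P.ρ k).functor.obj X) ≫ (P.θ (g * h) k).hom.app X ≫
        eqToHom (congrArg (fun a => (P.ρ a).functor.obj X) (mul_assoc g h k)) ≫
        (P.θ g (h * k)).inv.app X ≫ (P.ρ g).functor.map ((P.θ h k).inv.app X) =
      (c g h k : ℂ) • 𝟙 ((P.ρ g).functor.obj ((P.ρ h).functor.obj ((P.ρ k).functor.obj X)))

/-- The defect of associativity of `(ρ, θ)` is a `3`-cocycle with class `α ∈ H³(G, ℂˣ)`. -/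
def PreAction.HasClass (P : PreAction G D) (α : groupCohomology (coeff G) 3) : Prop :=
  ∃ z : groupCohomology.cocycles (coeff G) 3,
    P.IsDefect (fun g h k => toUnit (groupCohomology.iCocycles (coeff G) 3 z ![g, h, k])) ∧
      groupCohomology.π (coeff G) 3 z = α

/-- `(ρ, μ · θ)`, for a function `μ : G² → ℂˣ`. -/
def PreAction.twist (P : PreAction G D) (μ : G → G → ℂˣ) : PreAction G D where
  ρ := P.ρ
  θ g h :=
    { hom := (μ g h : ℂ) • (P.θ g h).hom
      inv := ((μ g h)⁻¹ : ℂˣ).val • (P.θ g h).inv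
      hom_inv_id := by simp [smul_smul]
      inv_hom_id := by simp [smul_smul] }

/-- The function `G² → ℂˣ` given by a `2`-cocycle. -/
def cocycleFun (z : groupCohomology.cocycles₂ (coeff G)) (g h : G) : ℂˣ :=
  toUnit (z.1 (g, h))

theorem cocycleFun_mul (z : groupCohomology.cocycles₂ (coeff G)) (g h k : G) :
    cocycleFun z (g * h) k * cocycleFun z g h = cocycleFun z h k * cocycleFun z g (h * k) := by
  have h1 := (groupCohomology.mem_cocycles₂_iff z.1).1 z.2 g h k
  exact congrArg toUnit h1

/-- The action `(ρ, z · θ)`, for a `2`-cocycle `z`. -/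
def GroupAction.twist (A : GroupAction G D) (z : groupCohomology.cocycles₂ (coeff G)) :
    GroupAction G D where
  toPreAction := A.toPreAction.twist (cocycleFun z)
  assoc := by
    intro g h k X
    have h1 := A.assoc g h k X
    have h2 : (cocycleFun z (g * h) k : ℂ) * cocycleFun z g h =
        cocycleFun z h k * cocycleFun z g (h * k) := by
      exact_mod_cast congrArg Units.val (cocycleFun_mul z g h k)
    simp only [PreAction.twist, NatTrans.app_smul, Linear.smul_comp, Linear.comp_smul,
      Functor.map_smul, smul_smul]
    rw [h1, h2, mul_comm]

/-- Twisting by a `2`-cocycle does not change the functors, hence preserves the lifts of `ι`. -/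
def Lift.twist {ι : G →* AutGroup D} (A : Lift ι) (z : groupCohomology.cocycles₂ (coeff G)) :
    Lift ι :=
  ⟨A.1.twist z, A.2⟩

end

/-- The reduction homomorphism `ℤ/n² → ℤ/n`, for the groups written multiplicatively. -/
def reduction (n : ℕ) : Multiplicative (ZMod (n ^ 2)) →* Multiplicative (ZMod n) :=
  AddMonoidHom.toMultiplicative
    (ZMod.castHom (dvd_pow_self n two_ne_zero) (ZMod n)).toAddMonoidHom

end CatAction

/-! The condition on `𝟭 D` forces any two isomorphisms between the same auto-equivalences to differ
by a nonzero scalar (`exists_unit_app_eq_smul`). So every choice of `θ` is associative up to scalars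
`c(g,h,k)`. Comparing the bracketings of a fourfold product makes `c` a cocycle
(`IsDefect.isCocycle`), and another choice of `(ρ, θ)` multiplies `c` by a coboundary
(`IsDefect.of_intertwines`). This gives the obstruction class. When both defects are trivial, the
comparing scalars form a 2-cocycle, which gives the torsor.

For (b) and (c) the class is killed by dimension shifting. In the functions `G → A`, with `g` acting
by `x ↦ x * g`, `c` is the coboundary of `(g, h) ↦ c(·, g, h)`. Modulo constants this is a
2-cocycle, which defines an extension `Ext c` of `G`. On `Ext c` the pullback of `c` is an explicit
coboundary (`Ext.coboundary_cochain`), so an action exists for every homomorphism into `Ext c`. For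
(b), `c` can be moved into the roots of unity of order dividing `|G|`, so that `Ext c` is finite.
For (c), take `A = ℂˣ`: a lift `p` of a generator has `p ^ n` in the kernel and commuting with `p`.
This makes `p ^ n` a character of `ℤ/n`, whence `p ^ (n ^ 2) = 1`.

If every object of `D` is zero, scalars are not determined by morphisms. Then `Aut D` is trivial and
its cohomology in positive degrees vanishes. -/

namespace CatAction

/-! ### Cocycles and coboundaries with values in `ℂˣ`, in multiplicative form. -/

section Cohomology

variable {G : Type w} [Group G]

/-- The multiplicative coboundary of a `2`-cochain with trivial action. -/
def coboundary {G A : Type*} [Mul G] [CommGroup A] (μ : G → G → A) (g h k : G) : A :=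
  μ h k * (μ (g * h) k)⁻¹ * μ g (h * k) * (μ g h)⁻¹

/-- The multiplicative `3`-cocycle condition with trivial action. -/
def IsCocycle {G A : Type*} [Group G] [CommGroup A] (c : G → G → G → A) : Prop :=
  ∀ g h k l, c g h k * c g (h * k) l * c h k l = c (g * h) k l * c g h (k * l)

theorem d_two_apply (y : (Fin 2 → G) → coeff G) (g h k : G) :
    toUnit ((inhomogeneousCochains.d (coeff G) 2).hom y ![g, h, k]) =
      coboundary (fun a b => toUnit (y ![a, b])) g h k := by
  have e1 : (fun i : Fin 2 => (![g, h, k] : Fin 3 → G) i.succ) = ![h, k] := by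
    funext i; fin_cases i <;> rfl
  have e2 : Fin.contractNth (0 : Fin 3) (· * ·) ![g, h, k] = ![g * h, k] := by
    funext i; fin_cases i <;> rfl
  have e3 : Fin.contractNth (1 : Fin 3) (· * ·) ![g, h, k] = ![g, h * k] := by
    funext i; fin_cases i <;> rfl
  have e4 : Fin.contractNth (2 : Fin 3) (· * ·) ![g, h, k] = ![g, h] := by
    funext i; fin_cases i <;> rfl
  rw [inhomogeneousCochains.d_hom_apply]
  rw [e1]
  refine (congrArg (fun t => toUnit (_ + t)) (Fin.sum_univ_three _)).trans ?_
  simp only [e2, e3, e4]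
  have e5 : ((-1 : ULift.{w} ℤ) ^ (((1 : Fin 3) : ℕ) + 1)) = 1 := by simp
  have e6 : ((-1 : ULift.{w} ℤ) ^ (((0 : Fin 3) : ℕ) + 1)) = -1 := by simp
  have e7 : ((-1 : ULift.{w} ℤ) ^ (((2 : Fin 3) : ℕ) + 1)) = -1 := by
    norm_num
  rw [e5, e6, e7]
  simp only [neg_smul, one_smul]
  have e8 : coboundary (fun a b => toUnit (y ![a, b])) g h k = toUnit (y ![h, k]) *
      ((toUnit (y ![g * h, k]))⁻¹ * toUnit (y ![g, h * k]) * (toUnit (y ![g, h]))⁻¹) := by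
    simp only [coboundary, mul_assoc]
  rw [e8]
  rfl

theorem d_three_apply (y : (Fin 3 → G) → coeff G) (g h k l : G) :
    toUnit ((inhomogeneousCochains.d (coeff G) 3).hom y ![g, h, k, l]) =
      toUnit (y ![h, k, l]) * ((toUnit (y ![g * h, k, l]))⁻¹ * toUnit (y ![g, h * k, l]) *
        (toUnit (y ![g, h, k * l]))⁻¹ * toUnit (y ![g, h, k])) := by
  have e1 : (fun i : Fin 3 => (![g, h, k, l] : Fin 4 → G) i.succ) = ![h, k, l] := by
    funext i; fin_cases i <;> rfl
  have e2 : Fin.contractNth (0 : Fin 4) (· * ·) ![g, h, k, l] = ![g * h, k, l] := by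
    funext i; fin_cases i <;> rfl
  have e3 : Fin.contractNth (1 : Fin 4) (· * ·) ![g, h, k, l] = ![g, h * k, l] := by
    funext i; fin_cases i <;> rfl
  have e4 : Fin.contractNth (2 : Fin 4) (· * ·) ![g, h, k, l] = ![g, h, k * l] := by
    funext i; fin_cases i <;> rfl
  have e4' : Fin.contractNth (3 : Fin 4) (· * ·) ![g, h, k, l] = ![g, h, k] := by
    funext i; fin_cases i <;> rfl
  rw [inhomogeneousCochains.d_hom_apply]
  rw [e1]
  refine (congrArg (fun t => toUnit (_ + t)) (Fin.sum_univ_four _)).trans ?_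
  simp only [e2, e3, e4, e4']
  have e5 : ((-1 : ULift.{w} ℤ) ^ (((1 : Fin 4) : ℕ) + 1)) = 1 := by simp
  have e6 : ((-1 : ULift.{w} ℤ) ^ (((0 : Fin 4) : ℕ) + 1)) = -1 := by simp
  have e7 : ((-1 : ULift.{w} ℤ) ^ (((2 : Fin 4) : ℕ) + 1)) = -1 := by
    norm_num
  have e8 : ((-1 : ULift.{w} ℤ) ^ (((3 : Fin 4) : ℕ) + 1)) = 1 := by
    norm_num
  rw [e5, e6, e7, e8]
  simp only [neg_smul, one_smul]
  rfl

/-- The function `G³ → ℂˣ` given by a `3`-cocycle. -/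
noncomputable def cocycleFun₃ (z : groupCohomology.cocycles (coeff G) 3) (g h k : G) : ℂˣ :=
  toUnit (groupCohomology.iCocycles (coeff G) 3 z ![g, h, k])

theorem cochain_three_ext {y y' : (Fin 3 → G) → coeff G}
    (h : ∀ a b c, toUnit (y ![a, b, c]) = toUnit (y' ![a, b, c])) : y = y' := by
  funext x
  have hx : x = ![x 0, x 1, x 2] := by
    funext i; fin_cases i <;> rfl
  rw [hx]
  exact ULift.ext _ _ (h _ _ _)

theorem exists_cocycleFun₃_eq {c : G → G → G → ℂˣ} (hc : IsCocycle c) :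
    ∃ z : groupCohomology.cocycles (coeff G) 3, cocycleFun₃ z = c := by
  let y : (Fin 3 → G) → coeff G := fun x => ULift.up (Additive.ofMul (c (x 0) (x 1) (x 2)))
  have hy : inhomogeneousCochains.d (coeff G) 3 y = 0 := by
    funext x
    have hx : x = ![x 0, x 1, x 2, x 3] := by
      funext i; fin_cases i <;> rfl
    rw [hx]
    refine ULift.ext _ _ ((d_three_apply y _ _ _ _).trans ?_)
    have h := hc (x 0) (x 1) (x 2) (x 3)
    change c (x 1) (x 2) (x 3) * ((c (x 0 * x 1) (x 2) (x 3))⁻¹ * c (x 0) (x 1 * x 2) (x 3) *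
      (c (x 0) (x 1) (x 2 * x 3))⁻¹ * c (x 0) (x 1) (x 2)) = 1
    have h' : c (x 1) (x 2) (x 3) * ((c (x 0 * x 1) (x 2) (x 3))⁻¹ * c (x 0) (x 1 * x 2) (x 3) *
      (c (x 0) (x 1) (x 2 * x 3))⁻¹ * c (x 0) (x 1) (x 2)) =
      (c (x 0) (x 1) (x 2) * c (x 0) (x 1 * x 2) (x 3) * c (x 1) (x 2) (x 3)) *
        (c (x 0 * x 1) (x 2) (x 3) * c (x 0) (x 1) (x 2 * x 3))⁻¹ := by
      rw [mul_inv]; ac_rfl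
    rw [h', h, mul_inv_cancel]
  refine ⟨groupCohomology.cocyclesMk y hy, ?_⟩
  funext g h k
  unfold cocycleFun₃
  rw [groupCohomology.iCocycles_mk]
  rfl

/-- Cohomology is the cokernel of the map from 2-cochains to 3-cocycles, so a class vanishes exactly
when its cocycle lies in the image of that map. -/
theorem π_three_eq_zero_iff (z : groupCohomology.cocycles (coeff G) 3) :
    groupCohomology.π (coeff G) 3 z = 0 ↔ ∃ μ : G → G → ℂˣ, cocycleFun₃ z = coboundary μ := by
  let K := groupCohomology.inhomogeneousCochains (coeff G)
  have hex : (ShortComplex.mk (K.toCycles 2 3) (K.homologyπ 3)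
      (K.toCycles_comp_homologyπ 2 3)).Exact :=
    ShortComplex.exact_of_g_is_cokernel _ (K.homologyIsCokernel 2 3 (by simp))
  rw [ShortComplex.moduleCat_exact_iff] at hex
  have hd : ∀ y : (Fin 2 → G) → coeff G, groupCohomology.iCocycles (coeff G) 3 (K.toCycles 2 3 y) =
      inhomogeneousCochains.d (coeff G) 2 y := by
    intro y
    have h1 : K.toCycles 2 3 ≫ K.iCycles 3 = inhomogeneousCochains.d (coeff G) 2 := by
      rw [K.toCycles_i]
      exact groupCohomology.inhomogeneousCochains.d_def (coeff G) 2
    exact congrArg (fun f => f.hom y) h1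
  constructor
  · intro hz
    obtain ⟨y, hy⟩ := hex z hz
    refine ⟨fun a b => toUnit ((show (Fin 2 → G) → coeff G from y) ![a, b]), ?_⟩
    funext g h k
    rw [← d_two_apply, ← hy]
    unfold cocycleFun₃
    erw [hd]
  · rintro ⟨μ, hμ⟩
    let y : (Fin 2 → G) → coeff G := fun x => ULift.up (Additive.ofMul (μ (x 0) (x 1)))
    have hz : z = K.toCycles 2 3 y := by
      have hinj : Function.Injective (groupCohomology.iCocycles (coeff G) 3) :=
        (ModuleCat.mono_iff_injective _).1 inferInstance
      apply hinj
      rw [hd]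
      refine cochain_three_ext fun a b c => ?_
      refine (congrFun (congrFun (congrFun hμ a) b) c).trans ?_
      exact (d_two_apply y a b c).symm
    rw [hz]
    have := congrArg (fun f => f.hom y) (K.toCycles_comp_homologyπ 2 3)
    exact this

theorem cocycleFun₃_sub (z z' : groupCohomology.cocycles (coeff G) 3) (g h k : G) :
    cocycleFun₃ (z - z') g h k = cocycleFun₃ z g h k / cocycleFun₃ z' g h k := by
  unfold cocycleFun₃
  rw [map_sub]
  rfl

theorem subsingleton_groupCohomology_succ [Subsingleton G] (n : ℕ) :
    Subsingleton (groupCohomology (coeff G) (n + 1)) :=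
  ModuleCat.subsingleton_of_isZero (isZero_groupCohomology_succ_of_subsingleton _ n)

theorem H2π_eq_zero_iff_exists (z : groupCohomology.cocycles₂ (coeff G)) :
    groupCohomology.H2π (coeff G) z = 0 ↔
      ∃ s : G → ℂˣ, ∀ g h, cocycleFun z g h = s h * (s (g * h))⁻¹ * s g := by
  rw [groupCohomology.H2π_eq_zero_iff]
  constructor
  · rintro ⟨y, hy⟩
    refine ⟨fun g => toUnit (y g), fun g h => ?_⟩
    have := congrFun hy (g, h)
    erw [groupCohomology.d₁₂_hom_apply] at this
    exact congrArg toUnit this.symm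
  · rintro ⟨s, hs⟩
    refine ⟨fun g => ULift.up (Additive.ofMul (s g)), ?_⟩
    funext ⟨g, h⟩
    erw [groupCohomology.d₁₂_hom_apply]
    exact ULift.ext _ _ (hs g h).symm

end Cohomology

/-! ### The extension of `G` that trivializes a 3-cocycle. -/

section Extension

variable {G A : Type*} [Group G] [CommGroup A]

/-- Cocycles are not assumed normalized. This and the next two identities control the values at `1`,
and explain the factor `c x 1 1` in the unit of the extension. -/
theorem IsCocycle.one_one_one {c : G → G → G → A} (hc : IsCocycle c) : c 1 1 1 = 1 := by
  simpa using hc 1 1 1 1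

theorem IsCocycle.one_mid_one {c : G → G → G → A} (hc : IsCocycle c) (g : G) : c 1 g 1 = 1 := by
  have h := hc 1 g 1 1
  simp only [mul_one, one_mul] at h
  have h' : c 1 g 1 * (c 1 g 1 * c g 1 1) = 1 * (c 1 g 1 * c g 1 1) := by
    rw [one_mul, ← mul_assoc, h, mul_comm]
  exact mul_right_cancel h'

theorem IsCocycle.mid_one {c : G → G → G → A} (hc : IsCocycle c) (x k : G) :
    c x 1 k = c x 1 1 * c 1 1 k := by
  have h := hc x 1 1 k
  simp only [mul_one, one_mul] at h
  have h' : (c x 1 1 * c 1 1 k) * c x 1 k = c x 1 k * c x 1 k := by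
    rw [← h]; ac_rfl
  exact (mul_right_cancel h').symm

/-- The extension of `G` by the group of functions `G → A` modulo constants (represented by the
functions with value `1` at `1`), on which the pullback of the `3`-cocycle `c` is a coboundary. -/
@[ext]
structure Ext (c : G → G → G → A) where
  fn : G → A
  fn_one : fn 1 = 1
  elt : G

namespace Ext

variable {c : G → G → G → A}

instance : Mul (Ext c) where
  mul p q :=
    { fn := fun x => p.fn x * q.fn (x * p.elt) * c x p.elt q.elt *
        (q.fn p.elt * c 1 p.elt q.elt)⁻¹
      fn_one := by simp [p.fn_one]
      elt := p.elt * q.elt }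

theorem mul_fn (p q : Ext c) (x : G) : (p * q).fn x =
    p.fn x * q.fn (x * p.elt) * c x p.elt q.elt * (q.fn p.elt * c 1 p.elt q.elt)⁻¹ := rfl

@[simp]
theorem mul_elt (p q : Ext c) : (p * q).elt = p.elt * q.elt := rfl

/-- The cochain trivializing the pullback of `c`. -/
def cochain (p q : Ext c) : A := q.fn p.elt * c 1 p.elt q.elt

theorem mul_fn' (p q : Ext c) (x : G) : (p * q).fn x * cochain p q =
    p.fn x * q.fn (x * p.elt) * c x p.elt q.elt := by
  rw [mul_fn, cochain, inv_mul_cancel_right]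

/-- The product of functions is renormalized by a constant to have value `1` at `1`, and `cochain`
is that constant. Evaluating the product `q * r` at `p.elt` and using the cocycle identity at `(1,
p, q, r)` shows that these constants fail to be a 2-cocycle exactly by `c`. -/
theorem cochain_mul (hc : IsCocycle c) (p q r : Ext c) :
    cochain q r * cochain p (q * r) =
      c p.elt q.elt r.elt * (cochain (p * q) r * cochain p q) := by
  have h1 := mul_fn' q r p.elt
  have h2 := hc 1 p.elt q.elt r.elt
  simp only [one_mul] at h2
  calc cochain q r * cochain p (q * r)
      = ((q * r).fn p.elt * cochain q r) * c 1 p.elt (q.elt * r.elt) := by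
        simp only [cochain, mul_elt]; ac_rfl
    _ = q.fn p.elt * r.fn (p.elt * q.elt) *
          (c p.elt q.elt r.elt * c 1 p.elt (q.elt * r.elt)) := by
        rw [h1]; ac_rfl
    _ = _ := by
        rw [← h2]; simp only [cochain, mul_elt]; ac_rfl

theorem coboundary_cochain (hc : IsCocycle c) (p q r : Ext c) :
    coboundary (cochain (c := c)) p q r = c p.elt q.elt r.elt := by
  have h := cochain_mul hc p q r
  have h' : coboundary (cochain (c := c)) p q r =
      (cochain q r * cochain p (q * r)) * (cochain (p * q) r * cochain p q)⁻¹ := by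
    rw [coboundary, mul_inv]; ac_rfl
  rw [h', h, mul_inv_cancel_right]

/-- Without the normalizing constants, the two bracketings differ at `x` by the cocycle identity at
`(x, p, q, r)`, that is, by the constant `c p q r`. By `cochain_mul` the normalizing constants
differ by the same factor. -/
theorem mul_assoc_of_isCocycle (hc : IsCocycle c) (p q r : Ext c) :
    p * q * r = p * (q * r) := by
  refine Ext.ext (funext fun x => ?_) (mul_assoc _ _ _)
  have h1 := mul_fn' (p * q) r x
  have h2 := mul_fn' p (q * r) x
  have h3 := mul_fn' p q x
  have h4 := mul_fn' q r (x * p.elt)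
  have h5 := cochain_mul hc p q r
  have h6 := hc x p.elt q.elt r.elt
  simp only [mul_elt, ← mul_assoc] at h1 h2 h3 h4 h6
  have e1 : (p * q * r).fn x * (cochain (p * q) r * cochain p q) * c p.elt q.elt r.elt =
      p.fn x * q.fn (x * p.elt) * r.fn (x * p.elt * q.elt) *
        (c x p.elt q.elt * c x (p.elt * q.elt) r.elt * c p.elt q.elt r.elt) := by
    calc _ = ((p * q * r).fn x * cochain (p * q) r) * cochain p q * c p.elt q.elt r.elt := by
          ac_rfl
      _ = ((p * q).fn x * cochain p q) * r.fn (x * p.elt * q.elt) *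
            (c x (p.elt * q.elt) r.elt * c p.elt q.elt r.elt) := by rw [h1]; ac_rfl
      _ = _ := by rw [h3]; ac_rfl
  have e2 : (p * (q * r)).fn x * (cochain q r * cochain p (q * r)) =
      p.fn x * q.fn (x * p.elt) * r.fn (x * p.elt * q.elt) *
        (c (x * p.elt) q.elt r.elt * c x p.elt (q.elt * r.elt)) := by
    calc _ = ((p * (q * r)).fn x * cochain p (q * r)) * cochain q r := by ac_rfl
      _ = ((q * r).fn (x * p.elt) * cochain q r) * p.fn x * c x p.elt (q.elt * r.elt) := by
          rw [h2]; ac_rfl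
      _ = _ := by rw [h4]; ac_rfl
  rw [h6, ← e2, h5] at e1
  have e3 : (p * q * r).fn x * (c p.elt q.elt r.elt * (cochain (p * q) r * cochain p q)) =
      (p * (q * r)).fn x * (c p.elt q.elt r.elt * (cochain (p * q) r * cochain p q)) := by
    rw [← e1]; ac_rfl
  exact mul_right_cancel e3

/-- The elements of the extension over `1 ∈ G`, shifted such that `1` goes to the unit. -/
def kernelElt (hc : IsCocycle c) (φ : G → A) (hφ : φ 1 = 1) : Ext c where
  fn x := φ x * (c x 1 1)⁻¹
  fn_one := by simp [hφ, hc.one_one_one]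
  elt := 1

theorem kernelElt_mul_fn (hc : IsCocycle c) (φ : G → A) (hφ : φ 1 = 1) (p : Ext c) (x : G) :
    (kernelElt hc φ hφ * p).fn x = φ x * p.fn x := by
  rw [mul_fn]
  simp only [kernelElt, mul_one, p.fn_one, one_mul]
  rw [hc.mid_one x p.elt]
  have : φ x * (c x 1 1)⁻¹ * p.fn x * (c x 1 1 * c 1 1 p.elt) * (c 1 1 p.elt)⁻¹ =
      φ x * p.fn x * ((c x 1 1)⁻¹ * c x 1 1) * (c 1 1 p.elt * (c 1 1 p.elt)⁻¹) := by ac_rfl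
  rw [this]; simp

theorem mul_kernelElt_fn (hc : IsCocycle c) (φ : G → A) (hφ : φ 1 = 1) (p : Ext c) (x : G) :
    (p * kernelElt hc φ hφ).fn x = p.fn x * φ (x * p.elt) * (φ p.elt)⁻¹ := by
  rw [mul_fn]
  simp only [kernelElt, hc.one_mid_one]
  have h := hc x p.elt 1 1
  simp only [mul_one] at h
  have h' : c x p.elt 1 * c p.elt 1 1 = c (x * p.elt) 1 1 := by
    apply mul_left_cancel (a := c x p.elt 1)
    rw [← mul_assoc, h, mul_comm]
  rw [← h']
  simp only [mul_inv, inv_inv, mul_one]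
  have : p.fn x * (φ (x * p.elt) * ((c x p.elt 1)⁻¹ * (c p.elt 1 1)⁻¹)) * c x p.elt 1 *
      ((φ p.elt)⁻¹ * c p.elt 1 1) = p.fn x * φ (x * p.elt) * (φ p.elt)⁻¹ *
      ((c x p.elt 1)⁻¹ * c x p.elt 1) * ((c p.elt 1 1)⁻¹ * c p.elt 1 1) := by ac_rfl
  rw [this]; simp

/-- The group structure of the extension. -/
@[reducible]
def group (hc : IsCocycle c) : Group (Ext c) :=
  letI : One (Ext c) := ⟨kernelElt hc 1 rfl⟩
  letI : Inv (Ext c) := ⟨fun p =>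
    { fn := fun x => (p.fn (x * p.elt⁻¹))⁻¹ * (c x p.elt⁻¹ p.elt)⁻¹ * (c x 1 1)⁻¹ *
        (p.fn p.elt⁻¹ * c 1 p.elt⁻¹ p.elt)
      fn_one := by
        rw [hc.one_one_one, one_mul, inv_one, mul_one, ← mul_inv, inv_mul_cancel]
      elt := p.elt⁻¹ }⟩
  Group.ofLeftAxioms (mul_assoc_of_isCocycle hc)
    (fun p => Ext.ext (funext fun x => by
      exact (kernelElt_mul_fn hc 1 rfl p x).trans (one_mul _)) (one_mul _))
    (fun p => Ext.ext (funext fun x => by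
      rw [mul_fn]
      change (p.fn (x * p.elt⁻¹))⁻¹ * (c x p.elt⁻¹ p.elt)⁻¹ * (c x 1 1)⁻¹ *
        (p.fn p.elt⁻¹ * c 1 p.elt⁻¹ p.elt) * p.fn (x * p.elt⁻¹) * c x p.elt⁻¹ p.elt *
        (p.fn p.elt⁻¹ * c 1 p.elt⁻¹ p.elt)⁻¹ = 1 * (c x 1 1)⁻¹
      have : (p.fn (x * p.elt⁻¹))⁻¹ * (c x p.elt⁻¹ p.elt)⁻¹ * (c x 1 1)⁻¹ *
        (p.fn p.elt⁻¹ * c 1 p.elt⁻¹ p.elt) * p.fn (x * p.elt⁻¹) * c x p.elt⁻¹ p.elt *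
        (p.fn p.elt⁻¹ * c 1 p.elt⁻¹ p.elt)⁻¹ =
        ((p.fn (x * p.elt⁻¹))⁻¹ * p.fn (x * p.elt⁻¹)) *
        ((c x p.elt⁻¹ p.elt)⁻¹ * c x p.elt⁻¹ p.elt) *
        ((p.fn p.elt⁻¹ * c 1 p.elt⁻¹ p.elt) * (p.fn p.elt⁻¹ * c 1 p.elt⁻¹ p.elt)⁻¹) *
          (c x 1 1)⁻¹ := by ac_rfl
      rw [this]; simp) (inv_mul_cancel p.elt))

/-- The projection of the extension to `G`. -/
def proj (hc : IsCocycle c) : letI := group hc; Ext c →* G :=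
  letI := group hc
  MonoidHom.mk' Ext.elt (fun _ _ => rfl)

theorem proj_surjective (hc : IsCocycle c) : Function.Surjective (proj hc) :=
  fun g => ⟨⟨1, rfl, g⟩, rfl⟩

instance [Finite G] [Finite A] : Finite (Ext c) :=
  Finite.of_injective (fun p : Ext c => (p.fn, p.elt)) (fun p q h => by
    simp only [Prod.mk.injEq] at h
    exact Ext.ext h.1 h.2)

theorem pow_sq_eq_one (hc : IsCocycle c) (p : Ext c) (hp : ∀ x : G, ∃ k : ℕ, x = p.elt ^ k)
    {n : ℕ} (hn : p.elt ^ n = 1) : letI := group hc; p ^ (n ^ 2) = 1 := by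
  let _ := group hc
  have hpn : (p ^ n).elt = 1 := (map_pow (proj hc) p n).trans hn
  -- Undoing the shift in `kernelElt` turns multiplication by `p ^ n` into pointwise multiplication
  -- by `φ`.
  let φ : G → A := fun x => (p ^ n).fn x * c x 1 1
  have hφ : φ 1 = 1 := by simp [φ, (p ^ n).fn_one, hc.one_one_one]
  have hpφ : p ^ n = kernelElt hc φ hφ :=
    Ext.ext (funext fun x => by simp [kernelElt, φ]) hpn
  have hcomm : kernelElt hc φ hφ * p = p * kernelElt hc φ hφ := by
    rw [← hpφ, ← pow_succ, ← pow_succ']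
  -- Left multiplication by `p ^ n` scales by `φ x`, right multiplication by `φ (x * p.elt) / φ
  -- p.elt`. As `p ^ n` commutes with `p`, `φ` is a character on the powers of `p.elt`.
  have hφm : ∀ x, φ (x * p.elt) = φ x * φ p.elt := by
    intro x
    have h := congrArg (fun q => Ext.fn q x) hcomm
    simp only [kernelElt_mul_fn, mul_kernelElt_fn] at h
    have h' : φ x = φ (x * p.elt) * (φ p.elt)⁻¹ := by
      apply mul_left_cancel (a := p.fn x)
      rw [mul_comm, h, mul_assoc]
    rw [h', inv_mul_cancel_right]
  have hφpow : ∀ k : ℕ, φ (p.elt ^ k) = φ p.elt ^ k := by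
    intro k
    induction k with
    | zero => simpa using hφ
    | succ k ih => rw [pow_succ, hφm, ih, pow_succ]
  have hφn : ∀ x, φ x ^ n = 1 := by
    intro x
    obtain ⟨k, rfl⟩ := hp x
    rw [hφpow, ← pow_mul, mul_comm, pow_mul, ← hφpow n, hn, hφ, one_pow]
  have hk : ∀ k : ℕ, ((kernelElt hc φ hφ) ^ k).elt = 1 ∧
      ∀ x, ((kernelElt hc φ hφ) ^ k).fn x = φ x ^ k * (c x 1 1)⁻¹ := by
    intro k
    induction k with
    | zero =>
      refine ⟨by rw [pow_zero]; rfl, fun x => ?_⟩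
      rw [pow_zero, pow_zero]; rfl
    | succ k ih =>
      rw [pow_succ']
      refine ⟨by rw [mul_elt, ih.1]; exact one_mul _, fun x => ?_⟩
      rw [kernelElt_mul_fn, ih.2, pow_succ' (φ x)]
      exact (mul_assoc (φ x) _ _).symm
  rw [pow_two, pow_mul, hpφ]
  refine Ext.ext (funext fun x => ?_) (hk n).1
  rw [(hk n).2, hφn]
  rfl

end Ext

/-- Over a finite group, a `3`-cocycle becomes a power-torsion cocycle after multiplication by a
coboundary. -/
theorem IsCocycle.exists_pow_eq_one [Finite G] {c : G → G → G → ℂˣ} (hc : IsCocycle c) :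
    ∃ μ : G → G → ℂˣ, ∀ g h k, (c g h k * coboundary μ g h k) ^ Nat.card G = 1 := by
  have := Fintype.ofFinite G
  have hroot : ∀ a : ℂˣ, ∃ b : ℂˣ, b ^ Nat.card G = a := by
    intro a
    obtain ⟨b, hb⟩ := IsAlgClosed.exists_pow_nat_eq (a : ℂ) (Nat.card_pos (α := G))
    have hb0 : b ≠ 0 := by
      rintro rfl
      rw [zero_pow Nat.card_pos.ne'] at hb
      exact a.ne_zero hb.symm
    exact ⟨Units.mk0 b hb0, Units.ext hb⟩
  -- The product of the cocycle identity over its last variable shows that `c ^ |G|` is the inverse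
  -- coboundary of `∏ l, c g h l`. Roots of order `|G|` of these products therefore correct `c`.
  choose μ hμ using fun g h => hroot (∏ l, c g h l)
  refine ⟨μ, fun g h k => ?_⟩
  have h1 : ∏ l, (c g h k * c g (h * k) l * c h k l) = ∏ l, (c (g * h) k l * c g h (k * l)) :=
    Finset.prod_congr rfl fun l _ => hc g h k l
  have h2 : ∏ l, c g h (k * l) = ∏ l, c g h l :=
    Fintype.prod_equiv (Equiv.mulLeft k) _ _ fun _ => rfl
  simp only [Finset.prod_mul_distrib, Finset.prod_const, Finset.card_univ, h2,
    ← Nat.card_eq_fintype_card, ← hμ] at h1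
  simp only [coboundary, mul_pow, inv_pow]
  have h3 : c g h k ^ Nat.card G * (μ h k ^ Nat.card G * (μ (g * h) k ^ Nat.card G)⁻¹ *
      μ g (h * k) ^ Nat.card G * (μ g h ^ Nat.card G)⁻¹) =
      (c g h k ^ Nat.card G * μ g (h * k) ^ Nat.card G * μ h k ^ Nat.card G) *
        (μ (g * h) k ^ Nat.card G * μ g h ^ Nat.card G)⁻¹ := by
    rw [mul_inv]; ac_rfl
  rw [h3, h1, mul_inv_cancel]

theorem isCocycle_coboundary (μ : G → G → A) : IsCocycle (coboundary μ) := by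
  intro g h k l
  -- The cancellation behind `δ² = 1`, put additively so that `abel` applies.
  have key : ∀ {B : Type _} [AddCommGroup B] (x1 x2 x3 x4 x5 x6 x7 x8 x9 x10 : B),
      (x1 + -x2 + x3 + -x4) + (x5 + -x6 + x7 + -x3) + (x8 + -x5 + x9 + -x1) =
      (x8 + -x6 + x10 + -x2) + (x9 + -x10 + x7 + -x4) := by
    intros; abel
  simp only [coboundary, mul_assoc g h k, mul_assoc h k l]
  exact key (B := Additive A) (μ h k) _ _ _ _ _ _ _ _ _

theorem IsCocycle.mul_coboundary {c : G → G → G → A} (hc : IsCocycle c) (μ : G → G → A) :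
    IsCocycle fun g h k => c g h k * coboundary μ g h k := by
  intro g h k l
  change c g h k * coboundary μ g h k * (c g (h * k) l * coboundary μ g (h * k) l) *
    (c h k l * coboundary μ h k l) = c (g * h) k l * coboundary μ (g * h) k l *
      (c g h (k * l) * coboundary μ g h (k * l))
  calc _ = (c g h k * c g (h * k) l * c h k l) *
        (coboundary μ g h k * coboundary μ g (h * k) l * coboundary μ h k l) := by ac_rfl
    _ = _ := by rw [hc, isCocycle_coboundary]; ac_rfl

end Extension

theorem hom_eq_of_not_exists {D : Type u} [Category.{v} D] [Preadditive D]
    (h : ¬ ∃ X : D, 𝟙 X ≠ 0) {X Y : D} (f f' : X ⟶ Y) : f = f' := by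
  push Not at h
  rw [← Category.id_comp f, ← Category.id_comp f', h X, Limits.zero_comp, Limits.zero_comp]

/-! ### Natural transformations of auto-equivalences are scalars. -/

section Scalars

variable {D : Type u} [Category.{v} D] [Preadditive D] [CategoryTheory.Linear ℂ D]

/-- Full faithfulness of `F` makes every endomorphism of `F` the image of an endomorphism of the
identity functor. -/
theorem exists_app_eq_smul (hD : ∀ α : 𝟭 D ⟶ 𝟭 D, ∃ c : ℂ, α = c • 𝟙 (𝟭 D)) {F : D ⥤ D}
    [F.Additive] [F.Linear ℂ] [F.IsEquivalence] (α : F ⟶ F) :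
    ∃ c : ℂ, ∀ X, α.app X = c • 𝟙 (F.obj X) := by
  obtain ⟨c, hc⟩ := hD
    { app := fun X => F.preimage (α.app X)
      naturality := fun X Y f => F.map_injective (by simp) }
  refine ⟨c, fun X => ?_⟩
  have h : F.preimage (α.app X) = c • 𝟙 X := congrArg (fun t => NatTrans.app t X) hc
  rw [← F.map_preimage (α.app X), h, F.map_smul, F.map_id]

theorem exists_unit_app_eq_smul (hD : ∀ α : 𝟭 D ⟶ 𝟭 D, ∃ c : ℂ, α = c • 𝟙 (𝟭 D)) {F F' : D ⥤ D}
    [F.Additive] [F.Linear ℂ] [F.IsEquivalence] (α β : F ≅ F') :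
    ∃ c : ℂˣ, ∀ X, α.hom.app X = (c : ℂ) • β.hom.app X := by
  obtain ⟨c, hc⟩ := exists_app_eq_smul hD (α.hom ≫ β.inv)
  have h : ∀ X, α.hom.app X = c • β.hom.app X := fun X => by
    have := hc X
    rw [NatTrans.comp_app] at this
    rw [← cancel_mono (β.inv.app X), this, Linear.smul_comp, Iso.hom_inv_id_app]
  -- An isomorphism can be zero only if all `F.obj X` are zero objects. Any unit then serves.
  by_cases h0 : c = 0
  · refine ⟨1, fun X => ?_⟩
    have hz : 𝟙 (F.obj X) = 0 := by
      rw [← Iso.hom_inv_id_app α X, h X, h0, zero_smul, Limits.zero_comp]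
    rw [← Category.id_comp (α.hom.app X), ← Category.id_comp (β.hom.app X), hz]
    simp
  · exact ⟨Units.mk0 c h0, h⟩

theorem smul_cancel_of_isIso {F : D ⥤ D} [F.Additive] [F.Faithful] {X Y : D} (hX : 𝟙 X ≠ 0)
    (f : F.obj X ⟶ Y) [IsIso f] {a b : ℂˣ} (h : (a : ℂ) • f = (b : ℂ) • f) : a = b := by
  have hf : f ≠ 0 := by
    intro h0
    apply hX
    apply F.map_injective
    rw [F.map_id, F.map_zero, ← IsIso.hom_inv_id f]
    exact (congrArg (· ≫ inv f) h0).trans Limits.zero_comp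
  exact Units.ext (smul_left_injective ℂ hf h)

theorem subsingleton_autGroup (h : ¬ ∃ X : D, 𝟙 X ≠ 0) : Subsingleton (AutGroup D) := by
  refine ⟨?_⟩
  rintro ⟨F⟩ ⟨F'⟩
  exact Quotient.sound ⟨NatIso.ofComponents
    (fun X => ⟨0, 0, hom_eq_of_not_exists h _ _, hom_eq_of_not_exists h _ _⟩)
    (fun _ => hom_eq_of_not_exists h _ _)⟩

end Scalars

/-! ### The associativity defect: cocycle condition, change of choices, restriction. -/

section Defect

variable {G : Type w} [Group G] {D : Type u} [Category.{v} D] [Preadditive D]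
  [CategoryTheory.Linear ℂ D]

namespace PreAction

/-- `θ_{g,h}` with the target indexed by any `k` equal to `gh`. -/
def mulIso (P : PreAction G D) {g h k : G} (e : g * h = k) :
    (P.ρ h).functor ⋙ (P.ρ g).functor ≅ (P.ρ k).functor :=
  P.θ g h ≪≫ eqToIso (congrArg (fun a => (P.ρ a).functor) e)

theorem mulIso_rfl (P : PreAction G D) (g h : G) : P.mulIso (rfl : g * h = g * h) = P.θ g h := by
  ext X
  simp [mulIso]

theorem mulIso_hom_app (P : PreAction G D) {g h k : G} (e : g * h = k) (X : D) :
    (P.mulIso e).hom.app X =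
      (P.θ g h).hom.app X ≫ eqToHom (congrArg (fun a => (P.ρ a).functor.obj X) e) := by
  subst e
  simp [mulIso]

theorem mulIso_naturality (P : PreAction G D) {g h k : G} (e : g * h = k) {X Y : D} (f : X ⟶ Y) :
    (P.mulIso e).hom.app X ≫ (P.ρ k).functor.map f =
      (P.ρ g).functor.map ((P.ρ h).functor.map f) ≫ (P.mulIso e).hom.app Y :=
  ((P.mulIso e).hom.naturality f).symm

/-- With the products as free indices, the associativity squares can be pasted without transporting
along `mul_assoc` by hand. -/
theorem isDefect_iff (P : PreAction G D) (c : G → G → G → ℂˣ) :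
    P.IsDefect c ↔ ∀ {g h k gh hk ghk : G} (e₁ : g * h = gh) (e₂ : h * k = hk)
      (e₃ : gh * k = ghk) (e₄ : g * hk = ghk) (X : D),
      (P.mulIso e₁).hom.app ((P.ρ k).functor.obj X) ≫ (P.mulIso e₃).hom.app X =
        (c g h k : ℂ) • ((P.ρ g).functor.map ((P.mulIso e₂).hom.app X) ≫
          (P.mulIso e₄).hom.app X) := by
  have key : ∀ g h k : G, ∀ X : D,
      ((P.θ g h).hom.app ((P.ρ k).functor.obj X) ≫ (P.θ (g * h) k).hom.app X ≫
        eqToHom (congrArg (fun a => (P.ρ a).functor.obj X) (mul_assoc g h k)) ≫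
        (P.θ g (h * k)).inv.app X ≫ (P.ρ g).functor.map ((P.θ h k).inv.app X) =
      (c g h k : ℂ) • 𝟙 ((P.ρ g).functor.obj ((P.ρ h).functor.obj ((P.ρ k).functor.obj X)))) ↔
      ((P.mulIso (rfl : g * h = _)).hom.app ((P.ρ k).functor.obj X) ≫
        (P.mulIso (rfl : g * h * k = _)).hom.app X =
        (c g h k : ℂ) • ((P.ρ g).functor.map ((P.mulIso (rfl : h * k = _)).hom.app X) ≫
          (P.mulIso (mul_assoc g h k).symm).hom.app X)) := by
    intro g h k X
    rw [mulIso_rfl, mulIso_rfl, mulIso_rfl, mulIso_hom_app,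
      ← cancel_mono ((P.ρ g).functor.map ((P.θ h k).hom.app X) ≫ (P.θ g (h * k)).hom.app X ≫
        eqToHom (congrArg (fun a => (P.ρ a).functor.obj X) (mul_assoc g h k).symm))]
    simp only [Category.assoc, Linear.smul_comp]
    rw [← Functor.map_comp_assoc, Iso.inv_hom_id_app]
    simp
  constructor
  · intro H g h k gh hk ghk e₁ e₂ e₃ e₄ X
    subst e₁ e₂ e₃
    exact (key g h k X).1 (H g h k X)
  · intro H g h k X
    exact (key g h k X).2 (H _ _ _ _ _)

theorem isAssoc_iff_isDefect_one (P : PreAction G D) :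
    P.IsAssoc ↔ P.IsDefect fun _ _ _ => 1 := by
  refine forall_congr' fun g => forall_congr' fun h => forall_congr' fun k =>
    forall_congr' fun X => ?_
  rw [← cancel_mono ((P.θ g (h * k)).inv.app X ≫ (P.ρ g).functor.map ((P.θ h k).inv.app X))]
  simp only [Category.assoc, Iso.hom_inv_id_app_assoc, Units.val_one, one_smul]
  rw [← Functor.map_comp, Iso.hom_inv_id_app, CategoryTheory.Functor.map_id]
  exact Iff.rfl

theorem exists_isDefect (hD : ∀ α : 𝟭 D ⟶ 𝟭 D, ∃ c : ℂ, α = c • 𝟙 (𝟭 D)) (P : PreAction G D) :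
    ∃ c, P.IsDefect c := by
  have key : ∀ g h k : G, ∃ c : ℂˣ, ∀ X,
      (P.mulIso (rfl : g * h = _)).hom.app ((P.ρ k).functor.obj X) ≫
        (P.mulIso (rfl : g * h * k = _)).hom.app X =
        (c : ℂ) • ((P.ρ g).functor.map ((P.mulIso (rfl : h * k = _)).hom.app X) ≫
          (P.mulIso (mul_assoc g h k).symm).hom.app X) := by
    intro g h k
    exact exists_unit_app_eq_smul hD
      (F := ((P.ρ k).functor ⋙ (P.ρ h).functor) ⋙ (P.ρ g).functor)
      (Functor.associator _ _ _ ≪≫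
        Functor.isoWhiskerLeft (P.ρ k).functor (P.mulIso (rfl : g * h = _)) ≪≫
          P.mulIso (rfl : g * h * k = _))
      (Functor.isoWhiskerRight (P.mulIso (rfl : h * k = _)) (P.ρ g).functor ≪≫
        P.mulIso (mul_assoc g h k).symm) |>.imp fun c hc X => by simpa using hc X
  choose c hc using key
  refine ⟨c, (isDefect_iff P c).2 ?_⟩
  intro g h k gh hk ghk e₁ e₂ e₃ e₄ X
  subst e₁ e₂ e₃
  exact hc g h k X

/-- The pentagon argument: `L` brackets to the left and `R` to the right. One path between them uses
three associativity squares, the other two squares and the naturality of `θ_{g,h}`. A nonzero object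
lets the scalars be compared. -/
theorem IsDefect.isCocycle (hne : ∃ X : D, 𝟙 X ≠ 0) {P : PreAction G D} {c : G → G → G → ℂˣ}
    (hc : P.IsDefect c) : IsCocycle c := by
  obtain ⟨X, hX⟩ := hne
  have H := fun {g h k gh hk ghk : G} => (isDefect_iff P c).1 hc (g := g) (h := h) (k := k)
    (gh := gh) (hk := hk) (ghk := ghk)
  intro g h k l
  let R := (P.ρ g).functor.map ((P.ρ h).functor.map ((P.mulIso (rfl : k * l = _)).hom.app X)) ≫
    (P.ρ g).functor.map ((P.mulIso (mul_assoc h k l).symm).hom.app X) ≫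
      (P.mulIso (show g * (h * k * l) = g * h * k * l by simp only [mul_assoc])).hom.app X
  let L := (P.mulIso (rfl : g * h = _)).hom.app ((P.ρ k).functor.obj ((P.ρ l).functor.obj X)) ≫
    (P.mulIso (rfl : g * h * k = _)).hom.app ((P.ρ l).functor.obj X) ≫
      (P.mulIso (rfl : g * h * k * l = _)).hom.app X
  have h1 : L = ((c g h k * c g (h * k) l * c h k l : ℂˣ) : ℂ) • R := by
    simp only [L, R]
    rw [← Category.assoc, H rfl rfl rfl (mul_assoc g h k).symm, Linear.smul_comp, Category.assoc,
      H (mul_assoc g h k).symm rfl rfl (by simp only [mul_assoc]), Linear.comp_smul,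
      ← Functor.map_comp_assoc, H rfl rfl rfl (mul_assoc h k l).symm, Functor.map_smul,
      Linear.smul_comp, Functor.map_comp_assoc]
    simp only [smul_smul, Units.val_mul, mul_assoc]
  have h2 : L = ((c (g * h) k l * c g h (k * l) : ℂˣ) : ℂ) • R := by
    simp only [L, R]
    rw [H rfl rfl rfl (mul_assoc (g * h) k l).symm, Linear.comp_smul,
      ← Category.assoc, mulIso_naturality, Category.assoc,
      H rfl (show h * (k * l) = h * k * l from (mul_assoc h k l).symm) _
        (by simp only [mul_assoc]), Linear.comp_smul]
    simp only [smul_smul, Units.val_mul]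
  exact smul_cancel_of_isIso
    (F := (P.ρ l).functor ⋙ (P.ρ k).functor ⋙ (P.ρ h).functor ⋙ (P.ρ g).functor) hX R
    (h1.symm.trans h2)

theorem IsDefect.unique (hne : ∃ X : D, 𝟙 X ≠ 0) {P : PreAction G D} {c c' : G → G → G → ℂˣ}
    (hc : P.IsDefect c) (hc' : P.IsDefect c') : c = c' := by
  obtain ⟨X, hX⟩ := hne
  funext g h k
  exact smul_cancel_of_isIso (F := (P.ρ k).functor ⋙ (P.ρ h).functor ⋙ (P.ρ g).functor) hX (𝟙 _)
    ((hc g h k X).symm.trans (hc' g h k X))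

/-- The isomorphisms `σ_g : ρ_g → ρ'_g` intertwine `θ` and `μθ'`. -/
def Intertwines (P P' : PreAction G D) (σ : ∀ g, (P.ρ g).functor ≅ (P'.ρ g).functor)
    (μ : G → G → ℂˣ) : Prop :=
  ∀ (g h : G) (X : D), (P.θ g h).hom.app X ≫ (σ (g * h)).hom.app X =
    (μ g h : ℂ) • ((σ g).hom.app ((P.ρ h).functor.obj X) ≫
      (P'.ρ g).functor.map ((σ h).hom.app X) ≫ (P'.θ g h).hom.app X)

theorem exists_intertwines (hD : ∀ α : 𝟭 D ⟶ 𝟭 D, ∃ c : ℂ, α = c • 𝟙 (𝟭 D))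
    (P P' : PreAction G D) (σ : ∀ g, (P.ρ g).functor ≅ (P'.ρ g).functor) :
    ∃ μ, P.Intertwines P' σ μ := by
  have key : ∀ g h : G, ∃ c : ℂˣ, ∀ X, (P.θ g h).hom.app X ≫ (σ (g * h)).hom.app X =
    (c : ℂ) • ((σ g).hom.app ((P.ρ h).functor.obj X) ≫
      (P'.ρ g).functor.map ((σ h).hom.app X) ≫ (P'.θ g h).hom.app X) := by
    intro g h
    exact exists_unit_app_eq_smul hD (F := (P.ρ h).functor ⋙ (P.ρ g).functor)
      (P.θ g h ≪≫ σ (g * h))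
      (Functor.isoWhiskerLeft (P.ρ h).functor (σ g) ≪≫
        Functor.isoWhiskerRight (σ h) (P'.ρ g).functor ≪≫ P'.θ g h)
  choose μ hμ using key
  exact ⟨μ, hμ⟩

theorem exists_iso_of_induced_eq {P P' : PreAction G D} (h : P.induced = P'.induced) :
    Nonempty (∀ g, (P.ρ g).functor ≅ (P'.ρ g).functor) :=
  Classical.nonempty_pi.2 fun g => Quotient.exact (DFunLike.congr_fun h g)

theorem Intertwines.mulIso {P P' : PreAction G D} {σ : ∀ g, (P.ρ g).functor ≅ (P'.ρ g).functor}
    {μ : G → G → ℂˣ} (H : P.Intertwines P' σ μ) {g h k : G} (e : g * h = k) (X : D) :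
    (P.mulIso e).hom.app X ≫ (σ k).hom.app X =
    (μ g h : ℂ) • ((σ g).hom.app ((P.ρ h).functor.obj X) ≫
      (P'.ρ g).functor.map ((σ h).hom.app X) ≫ (P'.mulIso e).hom.app X) := by
  subst e
  rw [mulIso_rfl, mulIso_rfl]
  exact H g h X

theorem IsDefect.of_intertwines {P P' : PreAction G D}
    {σ : ∀ g, (P.ρ g).functor ≅ (P'.ρ g).functor} {μ : G → G → ℂˣ} {c : G → G → G → ℂˣ}
    (H : P.Intertwines P' σ μ) (hc : P.IsDefect c) :
    P'.IsDefect fun g h k => c g h k * coboundary μ g h k := by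
  rw [isDefect_iff] at hc ⊢
  intro g h k gh hk ghk e₁ e₂ e₃ e₄ X
  -- `S` is the isomorphism `ρ_g ρ_h ρ_k → ρ'_g ρ'_h ρ'_k` induced by `σ`. Both sides of the
  -- associativity square are carried across it, each collecting two values of `μ`.
  let S := (σ g).hom.app ((P.ρ h).functor.obj ((P.ρ k).functor.obj X)) ≫
    (P'.ρ g).functor.map ((σ h).hom.app ((P.ρ k).functor.obj X)) ≫
      (P'.ρ g).functor.map ((P'.ρ h).functor.map ((σ k).hom.app X))
  have h1 : ((P.mulIso e₁).hom.app ((P.ρ k).functor.obj X) ≫ (P.mulIso e₃).hom.app X) ≫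
      (σ ghk).hom.app X = ((μ gh k * μ g h : ℂˣ) : ℂ) •
        (S ≫ (P'.mulIso e₁).hom.app ((P'.ρ k).functor.obj X) ≫ (P'.mulIso e₃).hom.app X) := by
    simp only [S]
    rw [Category.assoc, H.mulIso, Linear.comp_smul, ← Category.assoc, H.mulIso,
      Linear.smul_comp, smul_smul, Units.val_mul]
    congr 1
    simp only [Category.assoc]
    rw [← Category.assoc ((P'.mulIso e₁).hom.app _), mulIso_naturality]
    simp only [Category.assoc]
  have h2 : ((P.ρ g).functor.map ((P.mulIso e₂).hom.app X) ≫ (P.mulIso e₄).hom.app X) ≫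
      (σ ghk).hom.app X = ((μ h k * μ g hk : ℂˣ) : ℂ) •
        (S ≫ (P'.ρ g).functor.map ((P'.mulIso e₂).hom.app X) ≫ (P'.mulIso e₄).hom.app X) := by
    simp only [S]
    rw [Category.assoc, H.mulIso, Linear.comp_smul, ← Category.assoc, NatTrans.naturality,
      Category.assoc, ← Functor.map_comp_assoc, H.mulIso, Functor.map_smul,
      Linear.smul_comp, Linear.comp_smul, smul_smul, Units.val_mul, mul_comm (μ h k : ℂ)]
    congr 1
    simp only [Category.assoc, Functor.map_comp]
    rfl
  rw [hc e₁ e₂ e₃ e₄ X, Linear.smul_comp, h2, smul_smul] at h1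
  have : IsIso S := inferInstance
  rw [← cancel_epi S, Linear.comp_smul,
    ← smul_right_injective _ (Units.ne_zero (μ gh k * μ g h)) |>.eq_iff]
  refine h1.symm.trans ?_
  simp only [smul_smul, ← Units.val_mul]
  congr 2
  subst e₁ e₂
  simp only [coboundary]
  have : μ (g * h) k * μ g h * (c g h k * (μ h k * (μ (g * h) k)⁻¹ * μ g (h * k) * (μ g h)⁻¹)) =
    c g h k * (μ h k * μ g (h * k)) * (μ (g * h) k * (μ (g * h) k)⁻¹) * (μ g h * (μ g h)⁻¹) := by
    ac_rfl
  rw [this]; simp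

/-- The inverse appears because the scalar in `Intertwines` multiplies the target's `θ`. Twisting by
`μ` thus divides the defect by `coboundary μ`. -/
theorem intertwines_twist (P : PreAction G D) (μ : G → G → ℂˣ) :
    P.Intertwines (P.twist μ) (fun _ => Iso.refl _) fun g h => (μ g h)⁻¹ := by
  intro g h X
  change (P.θ g h).hom.app X ≫ 𝟙 _ = ((μ g h)⁻¹ : ℂˣ).val •
    (𝟙 _ ≫ (P.ρ g).functor.map (𝟙 _) ≫ ((μ g h : ℂ) • (P.θ g h).hom).app X)
  rw [CategoryTheory.Functor.map_id, Category.id_comp, Category.id_comp, Category.comp_id,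
    NatTrans.app_smul, smul_smul, Units.inv_mul, one_smul]

theorem isAssoc_twist {P : PreAction G D} {μ : G → G → ℂˣ} (h : P.IsDefect (coboundary μ)) :
    (P.twist μ).IsAssoc := by
  rw [isAssoc_iff_isDefect_one]
  convert h.of_intertwines (P.intertwines_twist μ) using 4
  rename_i g h k
  have : coboundary (fun g h => (μ g h)⁻¹) g h k = (coboundary μ g h k)⁻¹ := by
    simp only [coboundary, mul_inv]
  rw [this, mul_inv_cancel]

/-- The restriction along a homomorphism. -/
def comap {H : Type*} [Group H] (P : PreAction G D) (φ : H →* G) : PreAction H D where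
  ρ g := P.ρ (φ g)
  θ g h := P.mulIso (φ.map_mul g h).symm

theorem comap_mulIso {H : Type*} [Group H] (P : PreAction G D) (φ : H →* G) {g h k : H}
    (e : g * h = k) : (P.comap φ).mulIso e = P.mulIso (by rw [← e, map_mul]) := by
  subst e
  exact mulIso_rfl _ _ _

theorem IsDefect.comap {H : Type*} [Group H] {P : PreAction G D} {c : G → G → G → ℂˣ}
    (hc : P.IsDefect c) (φ : H →* G) :
    (P.comap φ).IsDefect fun g h k => c (φ g) (φ h) (φ k) := by
  rw [isDefect_iff] at hc ⊢
  intro g h k gh hk ghk e₁ e₂ e₃ e₄ X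
  simp only [comap_mulIso]
  exact hc _ _ _ _ X

theorem IsDefect.exists_groupAction {H : Type*} [Group H] {P : PreAction G D}
    {c : G → G → G → ℂˣ} (hc : P.IsDefect c) (φ : H →* G) (μ : H → H → ℂˣ)
    (hμ : ∀ g h k, coboundary μ g h k = c (φ g) (φ h) (φ k)) :
    ∃ A : GroupAction H D, A.induced = P.induced.comp φ := by
  have h1 : (P.comap φ).IsDefect (coboundary μ) := by
    have h2 : coboundary μ = fun g h k => c (φ g) (φ h) (φ k) := by
      funext g h k
      exact hμ g h k
    rw [h2]
    exact hc.comap φ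
  exact ⟨⟨(P.comap φ).twist μ, isAssoc_twist h1⟩, rfl⟩

theorem exists_induced_eq (ι : G →* AutGroup D) : ∃ P : PreAction G D, P.induced = ι := by
  choose ρ hρ using fun g => Quotient.exists_rep (ι g)
  have key : ∀ g h, Nonempty ((ρ h).functor ⋙ (ρ g).functor ≅ (ρ (g * h)).functor) := by
    intro g h
    have h1 : AutGroup.mk ((ρ g).comp (ρ h)) = AutGroup.mk (ρ (g * h)) := by
      have h2 : AutGroup.mk (ρ (g * h)) = AutGroup.mk (ρ g) * AutGroup.mk (ρ h) :=
        (hρ _).trans ((map_mul ι g h).trans (congrArg₂ (· * ·) (hρ g).symm (hρ h).symm))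
      exact h2.symm
    exact Quotient.exact h1
  exact ⟨⟨ρ, fun g h => (key g h).some⟩, MonoidHom.ext hρ⟩

end PreAction

end Defect

/-! ### The obstruction class, and actions of extensions of `G`. -/

section Obstruction

variable {G : Type w} [Group G] {D : Type u} [Category.{v} D] [Preadditive D]
  [CategoryTheory.Linear ℂ D]

namespace PreAction

theorem exists_isDefect_isCocycle (hD : ∀ α : 𝟭 D ⟶ 𝟭 D, ∃ c : ℂ, α = c • 𝟙 (𝟭 D))
    (P : PreAction G D) : ∃ c, P.IsDefect c ∧ IsCocycle c := by
  by_cases hne : ∃ X : D, 𝟙 X ≠ 0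
  · obtain ⟨c, hc⟩ := exists_isDefect hD P
    exact ⟨c, hc, hc.isCocycle hne⟩
  · exact ⟨fun _ _ _ => 1, fun _ _ _ _ => hom_eq_of_not_exists hne _ _, fun _ _ _ _ => by simp⟩

theorem exists_hasClass (hD : ∀ α : 𝟭 D ⟶ 𝟭 D, ∃ c : ℂ, α = c • 𝟙 (𝟭 D))
    (P : PreAction G D) : ∃ α, P.HasClass α := by
  obtain ⟨c, hc, hc'⟩ := exists_isDefect_isCocycle hD P
  obtain ⟨z, rfl⟩ := exists_cocycleFun₃_eq hc'
  exact ⟨_, z, hc, rfl⟩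

theorem HasClass.unique (hD : ∀ α : 𝟭 D ⟶ 𝟭 D, ∃ c : ℂ, α = c • 𝟙 (𝟭 D))
    (hne : ∃ X : D, 𝟙 X ≠ 0) {P P' : PreAction G D} (h : P.induced = P'.induced)
    {α α' : groupCohomology (coeff G) 3} (hα : P.HasClass α) (hα' : P'.HasClass α') : α = α' := by
  obtain ⟨z, hz, rfl⟩ := hα
  obtain ⟨z', hz', rfl⟩ := hα'
  obtain ⟨σ⟩ := exists_iso_of_induced_eq h
  obtain ⟨μ, hμ⟩ := exists_intertwines hD P P' σ
  have h1 := IsDefect.unique hne hz' (hz.of_intertwines hμ)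
  rw [eq_comm, ← sub_eq_zero, ← map_sub, π_three_eq_zero_iff]
  refine ⟨μ, ?_⟩
  funext g h k
  rw [cocycleFun₃_sub, div_eq_iff_eq_mul, mul_comm]
  exact congrFun (congrFun (congrFun h1 g) h) k

theorem hasClass_zero_of_isAssoc {P : PreAction G D} (h : P.IsAssoc) : P.HasClass 0 := by
  obtain ⟨z, hz⟩ := exists_cocycleFun₃_eq (G := G) (c := fun _ _ _ => 1) (fun _ _ _ _ => by simp)
  refine ⟨z, ?_, (π_three_eq_zero_iff z).2 ⟨fun _ _ => 1, ?_⟩⟩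
  · have h1 := (isAssoc_iff_isDefect_one P).1 h
    rw [← hz] at h1
    exact h1
  · rw [hz]
    funext g h k
    simp [coboundary]

theorem HasClass.exists_groupAction {P : PreAction G D} (h : P.HasClass 0) :
    ∃ A : GroupAction G D, A.induced = P.induced := by
  obtain ⟨z, hz, h0⟩ := h
  obtain ⟨μ, hμ⟩ := (π_three_eq_zero_iff z).1 h0
  have h1 : P.IsDefect (coboundary μ) := by
    rw [← hμ]
    exact hz
  exact ⟨⟨P.twist μ, isAssoc_twist h1⟩, rfl⟩

/-- The group `A` is kept general in order to serve both for roots of unity, where `Ext c` is finite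
if `G` is, and for `ℂˣ` itself. -/
theorem IsDefect.exists_groupAction_ext {A : Type*} [CommGroup A] {P : PreAction G D}
    (i : A →* ℂˣ) {c : G → G → G → A} (hP : P.IsDefect fun g h k => i (c g h k))
    (hc : IsCocycle c) {H : Type*} [Group H] :
    letI := Ext.group hc
    ∀ f : H →* Ext c, ∃ A : GroupAction H D, A.induced = P.induced.comp ((Ext.proj hc).comp f) := by
  let _ := Ext.group hc
  intro f
  refine hP.exists_groupAction _ (fun a b => i (Ext.cochain (f a) (f b))) fun g h k => ?_
  refine Eq.trans ?_ (congrArg i (Ext.coboundary_cochain hc (f g) (f h) (f k)))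
  simp only [coboundary, map_mul, map_inv]

theorem exists_finite_extension [Finite G]
    (hD : ∀ α : 𝟭 D ⟶ 𝟭 D, ∃ c : ℂ, α = c • 𝟙 (𝟭 D)) (P : PreAction G D) :
    ∃ (G' : Type) (_ : Group G') (_ : Finite G') (π : G' →* G), Function.Surjective π ∧
      ∃ A : GroupAction G' D, A.induced = P.induced.comp π := by
  obtain ⟨c, hPc, hc⟩ := exists_isDefect_isCocycle hD P
  obtain ⟨μ, hμ⟩ := hc.exists_pow_eq_one
  have : NeZero (Nat.card G) := ⟨Nat.card_pos.ne'⟩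
  let c' : G → G → G → rootsOfUnity (Nat.card G) ℂ := fun g h k =>
    ⟨c g h k * coboundary μ g h k, hμ g h k⟩
  have hc' : IsCocycle c' := fun g h k l => Subtype.ext (hc.mul_coboundary μ g h k l)
  have hP' : (P.twist fun g h => (μ g h)⁻¹).IsDefect
      fun g h k => (rootsOfUnity (Nat.card G) ℂ).subtype (c' g h k) := by
    have := hPc.of_intertwines (P.intertwines_twist fun g h => (μ g h)⁻¹)
    simp only [inv_inv] at this
    exact this
  let _ := Ext.group hc'
  -- `Ext c'` is finite, hence has a copy in the lowest universe.
  let e : Shrink.{0} (Ext c') ≃* Ext c' := Shrink.mulEquiv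
  exact ⟨Shrink.{0} (Ext c'), inferInstance, Finite.of_equiv _ e.symm.toEquiv,
    (Ext.proj hc').comp e.toMonoidHom, (Ext.proj_surjective hc').comp e.surjective,
    hP'.exists_groupAction_ext _ hc' e.toMonoidHom⟩

theorem exists_groupAction_cyclic (hD : ∀ α : 𝟭 D ⟶ 𝟭 D, ∃ c : ℂ, α = c • 𝟙 (𝟭 D))
    (P : PreAction G D) (n : ℕ) [NeZero n] (e : Multiplicative (ZMod n) ≃* G) :
    ∃ A : GroupAction (Multiplicative (ZMod (n ^ 2))) D,
      A.induced = P.induced.comp (e.toMonoidHom.comp (reduction n)) := by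
  obtain ⟨c, hPc, hc⟩ := exists_isDefect_isCocycle hD P
  let _ := Ext.group hc
  let p : Ext c := ⟨1, rfl, e (Multiplicative.ofAdd 1)⟩
  have hgen : ∀ x : G, ∃ k : ℕ, x = p.elt ^ k := by
    intro x
    obtain ⟨a, rfl⟩ := e.surjective x
    refine ⟨(Multiplicative.toAdd a).val, ?_⟩
    rw [← map_pow, ← ofAdd_nsmul, nsmul_one, ZMod.natCast_zmod_val]
    rfl
  have hpn : p.elt ^ n = 1 := by
    rw [← map_pow, ← ofAdd_nsmul, nsmul_one, ZMod.natCast_self, ofAdd_zero, map_one]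
  have hp := Ext.pow_sq_eq_one hc p hgen hpn
  -- The homomorphism `1 ↦ p`, well defined because `p ^ (n ^ 2) = 1`.
  let f : Multiplicative (ZMod (n ^ 2)) →* Ext c := AddMonoidHom.toMultiplicativeLeft
    (ZMod.lift (n ^ 2) ⟨zmultiplesHom (Additive (Ext c)) (Additive.ofMul p), by
      rw [zmultiplesHom_apply, natCast_zsmul, ← ofMul_pow, hp, ofMul_one]⟩)
  have hf : f (Multiplicative.ofAdd 1) = p := by
    have h1 := ZMod.lift_coe (n ^ 2) ⟨zmultiplesHom (Additive (Ext c)) (Additive.ofMul p), by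
      rw [zmultiplesHom_apply, natCast_zsmul, ← ofMul_pow, hp, ofMul_one]⟩ 1
    rw [Int.cast_one] at h1
    exact (congrArg Additive.toMul h1).trans (by simp)
  have hfe : (Ext.proj hc).comp f = e.toMonoidHom.comp (reduction n) := by
    refine MonoidHom.ext fun x => ?_
    have hx : x = Multiplicative.ofAdd 1 ^ (Multiplicative.toAdd x).val := by
      rw [← ofAdd_nsmul, nsmul_one, ZMod.natCast_zmod_val]
      rfl
    rw [hx, map_pow, map_pow]
    congr 1
    refine (congrArg (Ext.proj hc) hf).trans ?_
    change e (Multiplicative.ofAdd 1) = e (Multiplicative.ofAdd (ZMod.castHom (dvd_pow_self n two_ne_zero) (ZMod n) 1))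
    rw [map_one (ZMod.castHom _ _)]
  rw [← hfe]
  exact IsDefect.exists_groupAction_ext (MonoidHom.id _) hPc hc f

end PreAction

end Obstruction

/-! ### Lifts as a torsor under the second cohomology group. -/

section Torsor

variable {G : Type w} [Group G] {D : Type u} [Category.{v} D] [Preadditive D]
  [CategoryTheory.Linear ℂ D] {ι : G →* AutGroup D}

theorem cocycleFun_add (z z' : groupCohomology.cocycles₂ (coeff G)) (g h : G) :
    cocycleFun (z + z') g h = cocycleFun z g h * cocycleFun z' g h := rfl

theorem cocycleFun_sub (z z' : groupCohomology.cocycles₂ (coeff G)) (g h : G) :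
    cocycleFun (z - z') g h = cocycleFun z g h / cocycleFun z' g h := rfl

theorem exists_cocycleFun_eq {μ : G → G → ℂˣ} (h : coboundary μ = fun _ _ _ => 1) :
    ∃ z : groupCohomology.cocycles₂ (coeff G), cocycleFun z = μ := by
  refine ⟨⟨fun x => ULift.up (Additive.ofMul (μ x.1 x.2)),
    (groupCohomology.mem_cocycles₂_iff _).2 fun g h' k => ULift.ext _ _ ?_⟩, rfl⟩
  have h1 : coboundary μ g h' k = 1 := congrFun (congrFun (congrFun h g) h') k
  change μ (g * h') k * μ g h' = μ h' k * μ g (h' * k)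
  have h2 : μ h' k * μ g (h' * k) = coboundary μ g h' k * (μ (g * h') k * μ g h') := by
    have : coboundary μ g h' k * (μ (g * h') k * μ g h') = μ h' k * μ g (h' * k) *
        ((μ (g * h') k)⁻¹ * μ (g * h') k) * ((μ g h')⁻¹ * μ g h') := by
      simp only [coboundary]; ac_rfl
    rw [this]; simp
  rw [h2, h1, one_mul]

theorem div_eq_mul_inv_mul_iff {A : Type*} [CommGroup A] (a b x y t : A) :
    a / b = y * t⁻¹ * x ↔ t * a = x * (y * b) := by
  rw [div_eq_iff_eq_mul]
  have h : t * (y * t⁻¹ * x * b) = x * (y * b) := by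
    rw [← mul_one (x * (y * b)), ← mul_inv_cancel t]; ac_rfl
  rw [← h, mul_right_inj]

theorem smul_comp_smul_eq_iff {F : D ⥤ D} [F.Additive] [F.Linear ℂ] {X Y : D} (f : F.obj X ⟶ Y)
    (a b x y t : ℂˣ) :
    (((a : ℂ) • f) ≫ ((t : ℂ) • 𝟙 Y) =
      ((x : ℂ) • 𝟙 _) ≫ F.map ((y : ℂ) • 𝟙 X) ≫ ((b : ℂ) • f)) ↔
    ((t * a : ℂˣ) : ℂ) • f = ((x * (y * b) : ℂˣ) : ℂ) • f := by
  rw [F.map_smul, CategoryTheory.Functor.map_id]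
  simp only [Linear.comp_smul, Linear.smul_comp, Category.comp_id, Category.id_comp, smul_smul,
    Units.val_mul, mul_comm, mul_left_comm]

namespace GroupAction

theorem isomorphic_twist_of_H2π_eq (A : GroupAction G D)
    {z z' : groupCohomology.cocycles₂ (coeff G)}
    (h : groupCohomology.H2π (coeff G) z = groupCohomology.H2π (coeff G) z') :
    (A.twist z).Isomorphic (A.twist z') := by
  rw [← sub_eq_zero, ← map_sub, H2π_eq_zero_iff_exists] at h
  obtain ⟨s, hs⟩ := h
  let σ : ∀ g, (A.ρ g).functor ≅ (A.ρ g).functor := fun g =>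
    { hom := (s g : ℂ) • 𝟙 _
      inv := ((s g)⁻¹ : ℂˣ).val • 𝟙 _
      hom_inv_id := by
        rw [Linear.smul_comp, Linear.comp_smul, smul_smul, Units.mul_inv, one_smul,
          Category.id_comp]
      inv_hom_id := by
        rw [Linear.smul_comp, Linear.comp_smul, smul_smul, Units.inv_mul, one_smul,
          Category.id_comp] }
  refine ⟨σ, fun g h X => ?_⟩
  have h1 : ((cocycleFun z g h : ℂ) • (A.θ g h).hom.app X) ≫ ((s (g * h) : ℂ) • 𝟙 _) =
      ((s g : ℂ) • 𝟙 _) ≫ (A.ρ g).functor.map ((s h : ℂ) • 𝟙 _) ≫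
        ((cocycleFun z' g h : ℂ) • (A.θ g h).hom.app X) := by
    refine (smul_comp_smul_eq_iff (F := (A.ρ g).functor) ((A.θ g h).hom.app X) _ _ _ _ _).2 ?_
    rw [(div_eq_mul_inv_mul_iff _ _ _ _ _).1 ((cocycleFun_sub z z' g h).symm.trans (hs g h))]
  exact h1

/-- An isomorphism between two twists of one action consists of automorphisms of the `ρ_g`, hence of
scalars `s g`. Their coboundary is the quotient of the two cocycles. -/
theorem H2π_eq_of_isomorphic_twist (hD : ∀ α : 𝟭 D ⟶ 𝟭 D, ∃ c : ℂ, α = c • 𝟙 (𝟭 D))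
    (hne : ∃ X : D, 𝟙 X ≠ 0) (A : GroupAction G D) {z z' : groupCohomology.cocycles₂ (coeff G)}
    (h : (A.twist z).Isomorphic (A.twist z')) :
    groupCohomology.H2π (coeff G) z = groupCohomology.H2π (coeff G) z' := by
  obtain ⟨σ, hσ⟩ := h
  choose s hs using fun g => exists_unit_app_eq_smul hD (F := (A.ρ g).functor)
    (F' := (A.ρ g).functor) (σ g) (Iso.refl _)
  obtain ⟨X, hX⟩ := hne
  rw [← sub_eq_zero, ← map_sub, H2π_eq_zero_iff_exists]
  refine ⟨s, fun g h => ?_⟩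
  rw [cocycleFun_sub, div_eq_mul_inv_mul_iff]
  have h1 : ((cocycleFun z g h : ℂ) • (A.θ g h).hom.app X) ≫ (σ (g * h)).hom.app X =
      (σ g).hom.app _ ≫ (A.ρ g).functor.map ((σ h).hom.app X) ≫
        ((cocycleFun z' g h : ℂ) • (A.θ g h).hom.app X) := hσ g h X
  rw [hs, hs, hs] at h1
  exact smul_cancel_of_isIso (F := (A.ρ h).functor ⋙ (A.ρ g).functor) hX
    ((A.θ g h).hom.app X) ((smul_comp_smul_eq_iff (F := (A.ρ g).functor) _ _ _ _ _ _).1 h1)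

end GroupAction

namespace Lift

theorem mk_twist_eq_of_H2π_eq (A : Lift ι) {z z' : groupCohomology.cocycles₂ (coeff G)}
    (h : groupCohomology.H2π (coeff G) z = groupCohomology.H2π (coeff G) z') :
    LiftClasses.mk (A.twist z) = LiftClasses.mk (A.twist z') :=
  Quotient.sound (A.1.isomorphic_twist_of_H2π_eq h)

theorem mk_twist_congr {A B : Lift ι} (h : LiftClasses.mk A = LiftClasses.mk B)
    (z : groupCohomology.cocycles₂ (coeff G)) :
    LiftClasses.mk (A.twist z) = LiftClasses.mk (B.twist z) := by
  obtain ⟨σ, hσ⟩ : A.1.Isomorphic B.1 := Quotient.exact h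
  refine Quotient.sound ⟨σ, fun g h X => ?_⟩
  change ((cocycleFun z g h : ℂ) • (A.1.θ g h).hom).app X ≫ (σ (g * h)).hom.app X =
    (σ g).hom.app _ ≫ (B.1.ρ g).functor.map ((σ h).hom.app X) ≫
      ((cocycleFun z g h : ℂ) • (B.1.θ g h).hom).app X
  simp only [NatTrans.app_smul, Linear.smul_comp, Linear.comp_smul]
  rw [hσ g h X]

theorem mk_twist_twist (A : Lift ι) (z z' : groupCohomology.cocycles₂ (coeff G)) :
    LiftClasses.mk ((A.twist z').twist z) = LiftClasses.mk (A.twist (z + z')) := by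
  refine Quotient.sound ⟨fun g => Iso.refl _, fun g k X => ?_⟩
  change ((cocycleFun z g k : ℂ) • (cocycleFun z' g k : ℂ) • (A.1.θ g k).hom).app X ≫ 𝟙 _ =
    𝟙 _ ≫ (A.1.ρ g).functor.map (𝟙 _) ≫ ((cocycleFun (z + z') g k : ℂ) • (A.1.θ g k).hom).app X
  rw [CategoryTheory.Functor.map_id, Category.id_comp, cocycleFun_add, Units.val_mul, smul_smul]
  simp

theorem mk_twist_zero (A : Lift ι) :
    LiftClasses.mk (A.twist 0) = LiftClasses.mk A := by
  refine Quotient.sound ⟨fun g => Iso.refl _, fun g k X => ?_⟩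
  change (((1 : ℂˣ) : ℂ) • (A.1.θ g k).hom).app X ≫ 𝟙 _ =
    𝟙 _ ≫ (A.1.ρ g).functor.map (𝟙 _) ≫ (A.1.θ g k).hom.app X
  rw [CategoryTheory.Functor.map_id]
  simp

/-- Transitivity: the scalars `μ` comparing two actions have trivial coboundary because both defects
are `1`, so `μ` is a 2-cocycle. -/
theorem exists_mk_twist_eq (hD : ∀ α : 𝟭 D ⟶ 𝟭 D, ∃ c : ℂ, α = c • 𝟙 (𝟭 D)) (A B : Lift ι) :
    ∃ z, LiftClasses.mk (A.twist z) = LiftClasses.mk B := by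
  obtain ⟨σ⟩ := PreAction.exists_iso_of_induced_eq (B.2.trans A.2.symm)
  by_cases hne : ∃ X : D, 𝟙 X ≠ 0
  · obtain ⟨μ, hμ⟩ := PreAction.exists_intertwines hD B.1.toPreAction A.1.toPreAction σ
    have hB := (PreAction.isAssoc_iff_isDefect_one _).1 B.1.assoc
    have hA := (PreAction.isAssoc_iff_isDefect_one _).1 A.1.assoc
    have h1 := PreAction.IsDefect.unique hne (hB.of_intertwines hμ) hA
    simp only [one_mul] at h1
    obtain ⟨z, rfl⟩ := exists_cocycleFun_eq h1
    refine ⟨z, Eq.symm (Quotient.sound ⟨σ, fun g h X => ?_⟩)⟩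
    refine (hμ g h X).trans ?_
    change _ = (σ g).hom.app _ ≫ (A.1.ρ g).functor.map ((σ h).hom.app X) ≫
      ((cocycleFun z g h : ℂ) • (A.1.θ g h).hom).app X
    simp only [NatTrans.app_smul, Linear.comp_smul]
  · exact ⟨0, Eq.symm (Quotient.sound ⟨σ, fun _ _ _ => hom_eq_of_not_exists hne _ _⟩)⟩

end Lift

open Classical in
/-- The torsor structure on the isomorphism classes of lifts, for a free and transitive twisting
operation. -/
@[reducible]
noncomputable def LiftClasses.torsor (hD : ∀ α : 𝟭 D ⟶ 𝟭 D, ∃ c : ℂ, α = c • 𝟙 (𝟭 D))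
    (hfree : ∀ (A : Lift ι) (z z' : groupCohomology.cocycles₂ (coeff G)),
      LiftClasses.mk (A.twist z) = LiftClasses.mk (A.twist z') →
        groupCohomology.H2π (coeff G) z = groupCohomology.H2π (coeff G) z')
    (hne : Nonempty (Lift ι)) :
    AddTorsor (groupCohomology.H2 (coeff G)) (LiftClasses ι) :=
  have hsurj : Function.Surjective (groupCohomology.H2π (coeff G)) :=
    (ModuleCat.epi_iff_surjective _).1 inferInstance
  -- A class acts through a chosen representing cocycle; `hact` shows that the choice is immaterial.
  letI act : groupCohomology.H2 (coeff G) → LiftClasses ι → LiftClasses ι := fun x =>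
    Quotient.map (fun A => A.twist (hsurj x).choose)
      (fun _ _ h => Quotient.exact (Lift.mk_twist_congr (Quotient.sound h) _))
  have hact : ∀ (z : groupCohomology.cocycles₂ (coeff G)) (A : Lift ι),
      act (groupCohomology.H2π (coeff G) z) (LiftClasses.mk A) = LiftClasses.mk (A.twist z) :=
    fun z A => Lift.mk_twist_eq_of_H2π_eq A (hsurj _).choose_spec
  have htrans : ∀ p q : LiftClasses ι, ∃ x, act x q = p := by
    rintro ⟨A⟩ ⟨B⟩
    obtain ⟨z, hz⟩ := Lift.exists_mk_twist_eq hD B A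
    exact ⟨_, (hact z B).trans hz⟩
  have hinj : ∀ (p : LiftClasses ι) (x y), act x p = act y p → x = y := by
    rintro ⟨A⟩ x y h
    obtain ⟨z, rfl⟩ := hsurj x
    obtain ⟨z', rfl⟩ := hsurj y
    exact hfree A z z' ((hact z A).symm.trans (h.trans (hact z' A)))
  { vadd := act
    zero_vadd := by
      rintro ⟨A⟩
      have h := hact 0 A
      rw [map_zero] at h
      exact h.trans (Lift.mk_twist_zero A)
    add_vadd := by
      rintro x y ⟨A⟩
      obtain ⟨z, rfl⟩ := hsurj x
      obtain ⟨z', rfl⟩ := hsurj y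
      have h := hact (z + z') A
      rw [map_add] at h
      refine h.trans (Eq.trans ?_ (congrArg (act _) (hact z' A)).symm)
      exact (Lift.mk_twist_twist A z z').symm.trans (hact z (A.twist z')).symm
    vsub := fun p q => (htrans p q).choose
    nonempty := hne.map LiftClasses.mk
    vsub_vadd' := fun p q => (htrans p q).choose_spec
    vadd_vsub' := fun x p => hinj p _ _ (htrans _ p).choose_spec }

theorem LiftClasses.torsor_vadd (hD : ∀ α : 𝟭 D ⟶ 𝟭 D, ∃ c : ℂ, α = c • 𝟙 (𝟭 D))
    (hfree : ∀ (A : Lift ι) (z z' : groupCohomology.cocycles₂ (coeff G)),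
      LiftClasses.mk (A.twist z) = LiftClasses.mk (A.twist z') →
        groupCohomology.H2π (coeff G) z = groupCohomology.H2π (coeff G) z')
    (hne : Nonempty (Lift ι)) (z : groupCohomology.cocycles₂ (coeff G)) (A : Lift ι) :
    letI := LiftClasses.torsor hD hfree hne
    groupCohomology.H2π (coeff G) z +ᵥ LiftClasses.mk A = LiftClasses.mk (A.twist z) :=
  Lift.mk_twist_eq_of_H2π_eq A (Exists.choose_spec
    ((ModuleCat.epi_iff_surjective (groupCohomology.H2π (coeff G))).1 inferInstance _))

end Torsor

end CatAction

theorem mainTheorem2 (D : Type u) [CategoryTheory.Category.{v} D]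
    [CategoryTheory.Preadditive D] [CategoryTheory.Linear ℂ D]
    (hD : ∀ α : 𝟭 D ⟶ 𝟭 D, ∃ c : ℂ, α = c • 𝟙 (𝟭 D))
    (G : Subgroup (CatAction.AutGroup D)) [Finite G] :
    -- (a) the obstruction class
    (∃ α : groupCohomology (CatAction.coeff G) 3,
      (∃ P : CatAction.PreAction G D, P.induced = G.subtype) ∧
      (∀ P : CatAction.PreAction G D, P.induced = G.subtype →
        ∀ β : groupCohomology (CatAction.coeff G) 3, P.HasClass β ↔ β = α) ∧
      (α = 0 ↔ ∃ A : CatAction.GroupAction G D, A.induced = G.subtype)) ∧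
    -- (a) the torsor of lifts
    ((∃ A : CatAction.GroupAction G D, A.induced = G.subtype) →
      ∃ _torsor : AddTorsor (groupCohomology.H2 (CatAction.coeff G))
          (CatAction.LiftClasses G.subtype),
        ∀ (z : groupCohomology.cocycles₂ (CatAction.coeff G))
          (A : CatAction.Lift G.subtype),
          groupCohomology.H2π (CatAction.coeff G) z +ᵥ CatAction.LiftClasses.mk A =
            CatAction.LiftClasses.mk (A.twist z)) ∧
    -- (b)
    (∃ (G' : Type) (_ : Group G') (_ : Finite G') (π : G' →* G), Function.Surjective π ∧
      ∃ A : CatAction.GroupAction G' D, A.induced = G.subtype.comp π) ∧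
    -- (c)
    (∀ (n : ℕ) (e : Multiplicative (ZMod n) ≃* G),
      ∃ A : CatAction.GroupAction (Multiplicative (ZMod (n ^ 2))) D,
        A.induced = G.subtype.comp (e.toMonoidHom.comp (CatAction.reduction n))) := by
  obtain ⟨P, hP⟩ := CatAction.PreAction.exists_induced_eq G.subtype
  obtain ⟨α, hα⟩ := P.exists_hasClass hD
  have hsub : (¬ ∃ X : D, 𝟙 X ≠ 0) → Subsingleton G := fun h =>
    have := CatAction.subsingleton_autGroup h
    inferInstance
  have huniq : ∀ P' : CatAction.PreAction G D, P'.induced = G.subtype →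
      ∀ β, P'.HasClass β → β = α := by
    intro P' hP' β hβ
    by_cases hne : ∃ X : D, 𝟙 X ≠ 0
    · exact hβ.unique hD hne (hP'.trans hP.symm) hα
    · have := hsub hne
      exact (CatAction.subsingleton_groupCohomology_succ (G := G) 2).elim _ _
  refine ⟨⟨α, ⟨P, hP⟩, fun P' hP' β => ⟨huniq P' hP' β, ?_⟩, ?_, ?_⟩, ?_, ?_, ?_⟩
  · rintro rfl
    obtain ⟨β, hβ⟩ := P'.exists_hasClass hD
    exact huniq P' hP' β hβ ▸ hβ
  · rintro rfl
    obtain ⟨A, hA⟩ := hα.exists_groupAction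
    exact ⟨A, hA.trans hP⟩
  · rintro ⟨A, hA⟩
    exact (huniq _ hA 0 (CatAction.PreAction.hasClass_zero_of_isAssoc A.assoc)).symm
  · rintro ⟨A, hA⟩
    -- Scalars give freeness if `D` has a nonzero object. Otherwise `G` is trivial and its second
    -- cohomology vanishes.
    have hfree : ∀ (A : CatAction.Lift G.subtype)
        (z z' : groupCohomology.cocycles₂ (CatAction.coeff G)),
        CatAction.LiftClasses.mk (A.twist z) = CatAction.LiftClasses.mk (A.twist z') →
          groupCohomology.H2π (CatAction.coeff G) z =
            groupCohomology.H2π (CatAction.coeff G) z' := by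
      intro A z z' h
      by_cases hne : ∃ X : D, 𝟙 X ≠ 0
      · exact A.1.H2π_eq_of_isomorphic_twist hD hne (Quotient.exact h)
      · have := hsub hne
        exact (CatAction.subsingleton_groupCohomology_succ (G := G) 1).elim _ _
    exact ⟨CatAction.LiftClasses.torsor hD hfree ⟨⟨A, hA⟩⟩,
      CatAction.LiftClasses.torsor_vadd hD hfree ⟨⟨A, hA⟩⟩⟩
  · have h := P.exists_finite_extension hD
    rwa [hP] at h
  · intro n e
    -- `ZMod 0` is `ℤ`, which the finite group `G` cannot be isomorphic to.
    have : NeZero n := ⟨by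
      rintro rfl
      have : Finite (Multiplicative (ZMod 0)) := Finite.of_equiv G e.symm.toEquiv
      have : Finite ℤ := this
      exact not_finite ℤ⟩
    have h := P.exists_groupAction_cyclic hD n e
    rwa [hP] at h
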